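/- **Conventions.** For a set $C$ of ordinals, $\mathrm{acc}(C)$ is the set of all nonzero $\alpha\in C$ such that $C\cap\alpha$ is unbounded in $\alpha$; in particular $\mathrm{acc}(\kappa)$ is the set of nonzero limit ordinals below $\kappa$. A *club* in $\alpha$ is a closed unbounded subset of $\alpha$. Two conditions of a partial order are *compatible* if they have a common lower bound. A partial order is *$\kappa$-Knaster* if every set of $\kappa$ many conditions contains a subset of cardinality $\kappa$ consisting of pairwise compatible conditions, and it satisfies the *$\kappa$-chain condition* if every set of pairwise incompatible conditions has cardinality less than $\kappa$. For a cardinal $\mu$, $\mathbb{P}^\mu$ is the full support power, i.e. all functions from $\mu$ to $\mathbb{P}$ ordered coordinatewise. The principle $\square(\kappa)$ states that there is a sequence $\langle C_\alpha\mid\alpha\in\mathrm{acc}(\kappa)\rangle$ such that each $C_\alpha$ is club in $\alpha$; $C_\beta\cap\alpha=C_\alpha$ whenever $\alpha,\beta\in\mathrm{acc}(\kappa)$ and $\alpha\in\mathrm{acc}(C_\beta)$; and there is no club $D$ in $\kappa$ with $D\cap\alpha=C_\alpha$ for all $\alpha\in\mathrm{acc}(D)$. For infinite regular cardinals $\lambda<\kappa$,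 a *$\square^{\mathrm{ind}}(\kappa,\lambda)$-sequence* is a matrix $\vec{\mathcal C}=\langle C_{\alpha,i}\mid\alpha\in\mathrm{acc}(\kappa),\ i(\alpha)\le i<\lambda\rangle$ such that for all $\alpha,\beta\in\mathrm{acc}(\kappa)$: 1. $i(\alpha)<\lambda$; 2. $C_{\alpha,i}$ is club in $\alpha$ for $i(\alpha)\le i<\lambda$; 3. $C_{\alpha,i}\subseteq C_{\alpha,j}$ for $i(\alpha)\le i<j<\lambda$; 4. if $i(\beta)\le i<\lambda$ and $\alpha\in\mathrm{acc}(C_{\beta,i})$, then $i\ge i(\alpha)$ and $C_{\alpha,i}=C_{\beta,i}\cap\alpha$; 5. if $\alpha<\beta$, then $\alpha\in\mathrm{acc}(C_{\beta,i})$ for some $i(\beta)\le i<\lambda$; 6. there is no club $D$ in $\kappa$ such that for every $\alpha\in\mathrm{acc}(D)$ there is an $i$ with $i(\alpha)\le i<\lambda$ and $C_{\alpha,i}=D\cap\alpha$. For such $\vec{\mathcal C}$ and $i<\lambda$, let $\mathbb{T}_i^{\vec{\mathcal C}}$ be the tree on $\{\alpha\in\mathrm{acc}(\kappa)\mid i(\alpha)\le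 i\}$ with $\alpha<\beta$ iff $\alpha\in\mathrm{acc}(C_{\beta,i})$. For a tree $\mathbb{T}$, the *specializing poset* $\mathbb{P}(\mathbb{T})$ consists of all finite partial functions from $\mathbb{T}$ to $\omega$ that are injective on chains, ordered by reverse inclusion; its largest element is $\emptyset$. The *lottery sum* $\mathbb{P}_{\vec{\mathcal C}}$ consists of all pairs $\langle p,i\rangle$ with $i<\lambda$ and $p\in\mathbb{P}(\mathbb{T}_i^{\vec{\mathcal C}})$, where $\langle p,i\rangle\le\langle q,j\rangle$ iff either $i=j$ and $p\le q$, or $q=\emptyset$. This is a preorder, in which all pairs $\langle\emptyset,i\rangle$ are equivalent; it is regarded as a partial order by identifying equivalent conditions. **Theorem 1.4.** Let $\kappa$ be an uncountable regular cardinal such that $\square(\kappa)$ holds, and let $\lambda<\kappa$ be an infinite regular cardinal. Then there is a partial order $\mathbb{P}$ with the following properties: 1. If $\mu<\lambda$ is a (possibly finite) cardinal with $\nu^\mu<\kappa$ for all cardinals $\nu<\kappa$, then $\mathbb{P}^\mu$ is $\kappa$-Knaster. 2. $\mathbb{P}^\lambda$ does not satisfy the $\kappa$-chain condition. Moreover,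 $\mathbb{P}$ can be chosen to be (isomorphic to) the lottery sum $\mathbb{P}_{\vec{\mathcal C}}$ for some $\square^{\mathrm{ind}}(\kappa,\lambda)$-sequence $\vec{\mathcal C}$. -/

import Mathlib

universe u

open Cardinal Ordinal

/-- `α` is a limit point of `C`: `α` is nonzero and `C` is unbounded below `α`. -/
def IsLimitPoint (α : Ordinal.{u}) (C : Set Ordinal.{u}) : Prop :=
  α ≠ 0 ∧ ∀ β < α, ∃ γ ∈ C, β < γ ∧ γ < α

/-- The set `acc(C)` of limit points of `C` that belong to `C`. For the set `Set.Iio κ.ord` of all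
ordinals below `κ`, this is the set of nonzero limit ordinals below `κ`; for a club `C` in `α`, it
is the set of all limit points of `C` below `α`. -/
def accPoints (C : Set Ordinal.{u}) : Set Ordinal.{u} :=
  {α | α ∈ C ∧ IsLimitPoint α C}

/-- `C` is a closed unbounded subset of the ordinal `α`. -/
structure IsClubIn (C : Set Ordinal.{u}) (α : Ordinal.{u}) : Prop where
  subset : C ⊆ Set.Iio α
  closed : ∀ β < α, IsLimitPoint β C → β ∈ C
  unbounded : ∀ β < α, ∃ γ ∈ C, β ≤ γ

/-- `C` is a `□(κ)`-sequence. Only the values `C α` for limit ordinals `α < κ` matter. -/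
structure IsSquareSeq (κ : Cardinal.{u}) (C : Ordinal.{u} → Set Ordinal.{u}) : Prop where
  club : ∀ α ∈ accPoints (Set.Iio κ.ord), IsClubIn (C α) α
  coherent : ∀ α ∈ accPoints (Set.Iio κ.ord), ∀ β ∈ accPoints (Set.Iio κ.ord),
    α ∈ accPoints (C β) → C β ∩ Set.Iio α = C α
  no_thread : ¬ ∃ D : Set Ordinal.{u}, IsClubIn D κ.ord ∧
    ∀ α ∈ accPoints D, D ∩ Set.Iio α = C α

/-- The principle `□(κ)`. -/
def SquarePrinciple (κ : Cardinal.{u}) : Prop :=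
  ∃ C : Ordinal.{u} → Set Ordinal.{u}, IsSquareSeq κ C

/-- The matrix `⟨C α i ∣ α < κ, ind α ≤ i < l⟩` is an indexed square sequence for `κ` and `l`.
Only the values `ind α` and `C α i` for limit ordinals `α < κ` and `ind α ≤ i < l` matter. -/
structure IsIndexedSquareSeq (κ l : Cardinal.{u}) (ind : Ordinal.{u} → Ordinal.{u})
    (C : Ordinal.{u} → Ordinal.{u} → Set Ordinal.{u}) : Prop where
  ind_lt : ∀ α ∈ accPoints (Set.Iio κ.ord), ind α < l.ord
  club : ∀ α ∈ accPoints (Set.Iio κ.ord), ∀ i, ind α ≤ i → i < l.ord → IsClubIn (C α i) α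
  mono : ∀ α ∈ accPoints (Set.Iio κ.ord), ∀ i j, ind α ≤ i → i < j → j < l.ord → C α i ⊆ C α j
  coherent : ∀ α ∈ accPoints (Set.Iio κ.ord), ∀ β ∈ accPoints (Set.Iio κ.ord),
    ∀ i, ind β ≤ i → i < l.ord → α ∈ accPoints (C β i) →
      ind α ≤ i ∧ C α i = C β i ∩ Set.Iio α
  exists_mem : ∀ α ∈ accPoints (Set.Iio κ.ord), ∀ β ∈ accPoints (Set.Iio κ.ord), α < β →
    ∃ i, ind β ≤ i ∧ i < l.ord ∧ α ∈ accPoints (C β i)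
  no_thread : ¬ ∃ D : Set Ordinal.{u}, IsClubIn D κ.ord ∧
    ∀ α ∈ accPoints D, ∃ i, ind α ≤ i ∧ i < l.ord ∧ C α i = D ∩ Set.Iio α

/-- The underlying set of the `i`-th tree of the matrix: all limit ordinals `α < κ` with
`ind α ≤ i`. -/
def TreeNode (κ : Cardinal.{u}) (ind : Ordinal.{u} → Ordinal.{u}) (i : Ordinal.{u}) :
    Type (u + 1) :=
  {α : Ordinal.{u} // α ∈ accPoints (Set.Iio κ.ord) ∧ ind α ≤ i}

/-- The strict order of the `i`-th tree of the matrix: `α` is below `β` if and only if `α` is an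
accumulation point of `C β i`. -/
def treeLT (κ : Cardinal.{u}) (ind : Ordinal.{u} → Ordinal.{u})
    (C : Ordinal.{u} → Ordinal.{u} → Set Ordinal.{u}) (i : Ordinal.{u})
    (α β : TreeNode κ ind i) : Prop :=
  α.1 ∈ accPoints (C β.1 i)

/-- The specializing poset of a tree with strict order `r`: finite partial functions from the tree
to `ℕ` that are injective on chains. The value `none` means `undefined`. -/
@[ext]
structure SpecializingPoset {T : Type*} (r : T → T → Prop) where
  toFun : T → Option ℕ
  finite_dom : {t | toFun t ≠ none}.Finite
  injOn_chain : ∀ c : Set T, IsChain r c → Set.InjOn toFun (c ∩ {t | toFun t ≠ none})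

/-- Conditions are ordered by reverse inclusion: `p ≤ q` if and only if `p` extends `q`. -/
instance {T : Type*} (r : T → T → Prop) : PartialOrder (SpecializingPoset r) where
  le p q := ∀ t n, q.toFun t = some n → p.toFun t = some n
  le_refl _ _ _ h := h
  le_trans _ _ _ h₁ h₂ t n h := h₁ t n (h₂ t n h)
  le_antisymm _ _ h₁ h₂ :=
    SpecializingPoset.ext (funext fun t => Option.ext fun n => ⟨h₂ t n, h₁ t n⟩)

/-- The largest condition is the empty function. -/
instance {T : Type*} (r : T → T → Prop) : OrderTop (SpecializingPoset r) where
  top :=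
    { toFun := fun _ => none
      finite_dom := by simp
      injOn_chain := fun _ _ => by simp }
  le_top _ _ _ h := by cases h

/-- The conditions of the lottery sum of the family `Q`. -/
structure LotterySum {ι : Type*} (Q : ι → Type*) where
  index : ι
  cond : Q index

/-- `⟨i, p⟩ ≤ ⟨j, q⟩` if either `i = j` and `p ≤ q`, or `q` is the largest condition of `Q j`. -/
instance {ι : Type*} (Q : ι → Type*) [∀ i, PartialOrder (Q i)] [∀ i, OrderTop (Q i)] :
    Preorder (LotterySum Q) where
  le a b := (∃ (i : ι) (p q : Q i), a = ⟨i, p⟩ ∧ b = ⟨i, q⟩ ∧ p ≤ q) ∨ b.cond = ⊤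
  le_refl a := Or.inl ⟨a.index, a.cond, a.cond, rfl, rfl, le_rfl⟩
  le_trans a b c hab hbc := by
    rcases hbc with ⟨i, p, q, rfl, rfl, hpq⟩ | hc
    · rcases hab with ⟨j, p', q', rfl, h, hpq'⟩ | hb
      · cases h
        exact Or.inl ⟨_, p', q, rfl, rfl, hpq'.trans hpq⟩
      · exact Or.inr (top_le_iff.mp (hb ▸ hpq))
    · exact Or.inr hc

/-- The lottery sum of the specializing posets of the trees of the matrix with index `i < l`. -/
abbrev SquareLottery (κ l : Cardinal.{u}) (ind : Ordinal.{u} → Ordinal.{u})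
    (C : Ordinal.{u} → Ordinal.{u} → Set Ordinal.{u}) : Type (u + 1) :=
  LotterySum fun i : Set.Iio l.ord => SpecializingPoset (treeLT κ ind C i.1)

/-- Two conditions are compatible if they have a common extension. -/
def Compatible {P : Type*} [LE P] (p q : P) : Prop :=
  ∃ r, r ≤ p ∧ r ≤ q

/-- `P` is `κ`-Knaster: every set of `κ` many conditions contains a subset of cardinality `κ` that
consists of pairwise compatible conditions. -/
def IsKnaster (κ : Cardinal.{u}) (P : Type u) [LE P] : Prop :=
  ∀ A : Set P, #A = κ → ∃ B ⊆ A, #B = κ ∧ B.Pairwise Compatible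

/-- `P` satisfies the `κ`-chain condition: every antichain in `P` has cardinality less than `κ`. -/
def ChainCondition (κ : Cardinal.{u}) (P : Type u) [LE P] : Prop :=
  ∀ A : Set P, A.Pairwise (fun p q => ¬ Compatible p q) → #A < κ

/-- The full support power `P ^ μ`, ordered coordinatewise. -/
abbrev FullPower (P : Type u) (μ : Cardinal.{u}) : Type u :=
  μ.ord.ToType → P

universe v

/-! Write λ for `l`. The proof rests on a matrix whose index function exceeds each i < λ on a
stationary set of points of cofinality λ. It comes from a colouring with values below λ that is
constant along a modified □(κ)-sequence and takes values above each i stationarily often. Such a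
colouring exists because traces C_α ∩ δ split every stationary set: otherwise their stable values
would form a thread (`IsSquareSeq.exists_split`, `IsSquareSeq.exists_coloring`). The colour becomes
the index, and the row at β is glued from earlier rows along acc(C_β), or along an ω-ladder if
acc(C_β) is bounded in β (`exists_rows`). If D threaded the matrix, Fodor's lemma would give one
level i used by stationarily many rows; then all points of acc(D) would have index at most i, which
is impossible (`isIndexedSquareSeq_of_stationaryIn`).

In the λ-th power, α yields the condition with the singleton at α in every coordinate i ≥ ind α. Any
two nodes are comparable in some tree, so the corresponding coordinate makes the two conditions
incompatible (`not_chainCondition`).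

For μ < λ, the indices used by a condition are bounded by one i < λ. If cf(α) = λ and ind α > i,
then α is not a limit point of any C_{β,j} with β > α and j ≤ i, so a node at or above α has its
predecessors below α bounded in α. As there are only μ many finite domains, one bound below α serves
all of them. Fodor's lemma fixes this bound, ν^μ < κ allows fixing the parts of the conditions below
it, and what remains is pairwise compatible (`isKnaster_fullPower`). -/

/-! ### Clubs, stationary sets and pressing down. -/

theorem exists_bound_of_lt_cof {ι : Type v} {a : Ordinal.{u}}
    (h : Cardinal.lift.{u} #ι < Cardinal.lift.{v} a.cof) (g : ι → Ordinal.{u})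
    (hg : ∀ i, g i < a) : ∃ b < a, ∀ i, g i < b := by
  have : Small.{u} ι := by
    obtain ⟨ν, hν⟩ := Cardinal.mem_range_lift_of_le h.le
    obtain ⟨e⟩ : Nonempty (ι ≃ ν.out) := by
      rw [← Cardinal.lift_mk_eq', ← hν]
      simp
    exact ⟨_, ⟨e⟩⟩
  exact ⟨⨆ i, (g i + 1), lift_iSup_add_one_lt_of_lt_cof (by rwa [← lift_cof]) hg,
    fun i => (lt_add_one _).trans_le (le_ciSup (f := fun i => g i + 1) bddAbove_of_small i)⟩

theorem exists_bound_of_lt_ord {κ : Cardinal.{u}} (hκ : κ.IsRegular) {δ : Ordinal.{u}}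
    (hδ : δ < κ.ord) (g : Ordinal.{u} → Ordinal.{u}) (hg : ∀ γ < δ, g γ < κ.ord) :
    ∃ b < κ.ord, ∀ γ < δ, g γ < b := by
  obtain ⟨b, hb, h⟩ := exists_bound_of_lt_cof (ι := Set.Iio δ) (a := κ.ord)
    (by
      rw [Cardinal.mk_Iio_ordinal, hκ.cof_ord, Cardinal.lift_lift, Cardinal.lift_lt.{u, u + 1}]
      exact Cardinal.lt_ord.1 hδ) (fun γ => g γ.1) (fun γ => hg _ γ.2)
  exact ⟨b, hb, fun γ hγ => h ⟨γ, hγ⟩⟩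

theorem add_one_lt_ord {κ : Cardinal.{u}} (hκ : κ.IsRegular) {x : Ordinal.{u}} (hx : x < κ.ord) :
    x + 1 < κ.ord :=
  (isSuccLimit_ord hκ.aleph0_le).add_one_lt hx

/-- Closure points of a function replace diagonal intersections throughout. Zero is excluded because
it is vacuously closed under F but never a limit point. -/
theorem isClubIn_closed_under {κ : Cardinal.{u}} (hκ : κ.IsRegular) (hunc : ℵ₀ < κ)
    (F : Ordinal.{u} → Ordinal.{u}) (hF : ∀ α < κ.ord, F α < κ.ord) :
    IsClubIn {δ | δ < κ.ord ∧ δ ≠ 0 ∧ ∀ α < δ, F α < δ} κ.ord where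
  subset _ h := h.1
  closed β hβ h := by
    refine ⟨hβ, h.1, fun α hα => ?_⟩
    obtain ⟨γ, hγ, h1, h2⟩ := h.2 α hα
    exact (hγ.2.2 α h1).trans h2
  unbounded β hβ := by
    have : ∀ x, ∃ b, x < κ.ord → b < κ.ord ∧ x < b ∧ ∀ α < x, F α < b := by
      intro x
      by_cases hx : x < κ.ord
      · obtain ⟨b, hb, h⟩ := exists_bound_of_lt_ord hκ hx F fun γ hγ => hF γ (hγ.trans hx)
        exact ⟨max b (x + 1), fun _ => ⟨max_lt hb (add_one_lt_ord hκ hx),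
          (lt_add_one x).trans_le (le_max_right _ _),
          fun α hα => (h α hα).trans_le (le_max_left _ _)⟩⟩
      · exact ⟨0, fun h => absurd h hx⟩
    choose G hG using this
    have hn : ∀ n, G^[n] β < κ.ord := by
      intro n
      induction n with
      | zero => exact hβ
      | succ n ih => rw [Function.iterate_succ_apply']; exact (hG _ ih).1
    have hlt : nfp G β < κ.ord := by
      rw [← iSup_iterate_eq_nfp]
      refine lift_iSup_lt_of_lt_cof ?_ hn
      simpa [hκ.cof_ord] using hunc
    refine ⟨nfp G β, ⟨hlt, ?_, ?_⟩, le_nfp G β⟩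
    · have h1 := (hG _ hβ).2.1
      have h2 := iterate_le_nfp G β 1
      exact ne_of_gt (zero_le.trans_lt (h1.trans_le h2))
    · intro α hα
      rw [lt_nfp_iff] at hα
      obtain ⟨n, hn'⟩ := hα
      have := (hG _ (hn n)).2.2 α hn'
      rw [← Function.iterate_succ_apply' G] at this
      exact this.trans_le (iterate_le_nfp G β (n + 1))

/-- `S` meets every club in `κ`. -/
def StationaryIn (κ : Cardinal.{u}) (S : Set Ordinal.{u}) : Prop :=
  ∀ D : Set Ordinal.{u}, IsClubIn D κ.ord → ∃ α ∈ S, α ∈ D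

theorem StationaryIn.mono {κ : Cardinal.{u}} {S T : Set Ordinal.{u}} (hS : StationaryIn κ S)
    (h : S ⊆ T) : StationaryIn κ T := fun D hD =>
  let ⟨α, h1, h2⟩ := hS D hD
  ⟨α, h h1, h2⟩

/-- Fodor's pressing down lemma. -/
theorem StationaryIn.exists_fiber {κ : Cardinal.{u}} (hκ : κ.IsRegular) (hunc : ℵ₀ < κ)
    {S : Set Ordinal.{u}} (hS : StationaryIn κ S) (f : Ordinal.{u} → Ordinal.{u})
    (hf : ∀ α ∈ S, α < κ.ord → f α < α) : ∃ γ < κ.ord, StationaryIn κ {α ∈ S | f α = γ} := by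
  by_contra! hcon
  have hD : ∀ γ, ∃ D, γ < κ.ord → IsClubIn D κ.ord ∧ ∀ α ∈ S, α ∈ D → f α ≠ γ := by
    intro γ
    by_cases hγ : γ < κ.ord
    · have := hcon γ hγ
      simp only [StationaryIn, not_forall] at this
      obtain ⟨D, hD, h⟩ := this
      exact ⟨D, fun _ => ⟨hD, fun α hα hαD hfα => h ⟨α, ⟨hα, hfα⟩, hαD⟩⟩⟩
    · exact ⟨∅, fun h => absurd h hγ⟩
  choose D hD using hD
  have hN : ∀ γ x, ∃ y, γ < κ.ord → x < κ.ord → y < κ.ord ∧ y ∈ D γ ∧ x < y := by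
    intro γ x
    by_cases h : γ < κ.ord ∧ x < κ.ord
    · obtain ⟨y, hy, hxy⟩ := (hD γ h.1).1.unbounded _ (add_one_lt_ord hκ h.2)
      exact ⟨y, fun _ _ => ⟨(hD γ h.1).1.subset hy, hy, (lt_add_one x).trans_le hxy⟩⟩
    · exact ⟨0, fun h1 h2 => absurd ⟨h1, h2⟩ h⟩
  choose N hN using hN
  -- B x bounds the next points of all D γ with γ ≤ x, so a closure point of B is a limit point of D
  -- γ for every γ below it.
  have hB : ∀ x, ∃ b, x < κ.ord → b < κ.ord ∧ ∀ γ < x + 1, N γ x < b := by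
    intro x
    by_cases hx : x < κ.ord
    · obtain ⟨b, hb, h⟩ := exists_bound_of_lt_ord hκ (add_one_lt_ord hκ hx) (fun γ => N γ x)
        (fun γ hγ => (hN γ x (hγ.trans (add_one_lt_ord hκ hx)) hx).1)
      exact ⟨b, fun _ => ⟨hb, h⟩⟩
    · exact ⟨0, fun h => absurd h hx⟩
  choose B hB using hB
  obtain ⟨δ, hδS, hδ, hδ0, hcl⟩ := hS _ (isClubIn_closed_under hκ hunc B fun x hx => (hB x hx).1)
  have hlt := hf δ hδS hδ
  have hfκ := hlt.trans hδ
  refine (hD (f δ) hfκ).2 δ hδS ((hD (f δ) hfκ).1.closed δ hδ ⟨hδ0, fun β hβ => ?_⟩) rfl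
  have hm := max_lt hβ hlt
  have hmκ := hm.trans hδ
  obtain ⟨h1, h2, h3⟩ := hN (f δ) (max β (f δ)) hfκ hmκ
  exact ⟨_, h2, (le_max_left _ _).trans_lt h3,
    ((hB _ hmκ).2 (f δ) (Order.lt_add_one_iff.2 (le_max_right _ _))).trans (hcl _ hm)⟩

theorem IsClubIn.stationaryIn_inter {κ : Cardinal.{u}} (hκ : κ.IsRegular) (hunc : ℵ₀ < κ)
    {S D : Set Ordinal.{u}} (hD : IsClubIn D κ.ord) (hS : StationaryIn κ S) :
    StationaryIn κ (S ∩ D) := by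
  intro E hE
  have hN : ∀ x, ∃ b, x < κ.ord → b < κ.ord ∧ (∃ y ∈ D, x < y ∧ y < b) ∧
      ∃ y ∈ E, x < y ∧ y < b := by
    intro x
    by_cases hx : x < κ.ord
    · obtain ⟨y, hy, hxy⟩ := hD.unbounded _ (add_one_lt_ord hκ hx)
      obtain ⟨z, hz, hxz⟩ := hE.unbounded _ (add_one_lt_ord hκ hx)
      refine ⟨max y z + 1, fun _ => ⟨add_one_lt_ord hκ (max_lt (hD.subset hy) (hE.subset hz)),
        ⟨y, hy, (lt_add_one x).trans_le hxy, Order.lt_add_one_iff.2 (le_max_left _ _)⟩,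
        ⟨z, hz, (lt_add_one x).trans_le hxz, Order.lt_add_one_iff.2 (le_max_right _ _)⟩⟩⟩
    · exact ⟨0, fun h => absurd h hx⟩
  choose F hF using hN
  obtain ⟨δ, hδS, hδ, hδ0, hcl⟩ := hS _ (isClubIn_closed_under hκ hunc F fun x hx => (hF x hx).1)
  refine ⟨δ, ⟨hδS, hD.closed δ hδ ⟨hδ0, fun β hβ => ?_⟩⟩,
    hE.closed δ hδ ⟨hδ0, fun β hβ => ?_⟩⟩
  · obtain ⟨y, hy, h1, h2⟩ := (hF β (hβ.trans hδ)).2.1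
    exact ⟨y, hy, h1, h2.trans (hcl β hβ)⟩
  · obtain ⟨y, hy, h1, h2⟩ := (hF β (hβ.trans hδ)).2.2
    exact ⟨y, hy, h1, h2.trans (hcl β hβ)⟩

theorem isClubIn_Ioo {κ : Cardinal.{u}} (hκ : κ.IsRegular) {η : Ordinal.{u}} (hη : η < κ.ord) :
    IsClubIn (Set.Ioo η κ.ord) κ.ord where
  subset _ h := h.2
  closed β hβ h := by
    obtain ⟨γ, hγ, -, h2⟩ := h.2 0 (pos_iff_ne_zero.2 h.1)
    exact ⟨hγ.1.trans h2, hβ⟩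
  unbounded β hβ := ⟨max β η + 1, ⟨Order.lt_add_one_iff.2 (le_max_right _ _),
    add_one_lt_ord hκ (max_lt hβ hη)⟩, (le_max_left _ _).trans (lt_add_one _).le⟩

theorem StationaryIn.exists_gt {κ : Cardinal.{u}} (hκ : κ.IsRegular) {S : Set Ordinal.{u}}
    (hS : StationaryIn κ S) {η : Ordinal.{u}} (hη : η < κ.ord) : ∃ α ∈ S, η < α ∧ α < κ.ord :=
  hS _ (isClubIn_Ioo hκ hη)

/-- A function on a stationary set with fewer than `κ` values has a stationary fiber. -/
theorem StationaryIn.exists_fiber_of_small {κ : Cardinal.{u}} (hκ : κ.IsRegular) (hunc : ℵ₀ < κ)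
    {S : Set Ordinal.{u}} (hS : StationaryIn κ S) {X : Type v}
    (hX : Cardinal.lift.{u} #X < Cardinal.lift.{v} κ) (f : Ordinal.{u} → X) :
    ∃ x, StationaryIn κ {α ∈ S | f α = x} := by
  obtain ⟨ν, hν⟩ := Cardinal.mem_range_lift_of_le hX.le
  rw [← hν, Cardinal.lift_lt] at hX
  have e : Nonempty (X ≃ ν.ord.ToType) := by
    rw [← Cardinal.lift_mk_eq', ← hν]
    simp
  obtain ⟨e⟩ := e
  have hlt : ∀ x, ((ToType.mk.symm (e x)) : Ordinal) < ν.ord := fun x => (ToType.mk.symm (e x)).2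
  have hνκ : ν.ord < κ.ord := Cardinal.ord_lt_ord.2 hX
  -- Coded by ordinals below ν, the function is regressive above ν.
  obtain ⟨γ, -, h⟩ := ((isClubIn_Ioo hκ hνκ).stationaryIn_inter hκ hunc hS).exists_fiber hκ hunc
    (fun α => (ToType.mk.symm (e (f α))).1) (fun α hα _ => (hlt _).trans hα.2.1)
  obtain ⟨α, hα, -, -⟩ := h.exists_gt hκ hκ.ord_pos
  refine ⟨f α, h.mono fun β hβ => ⟨hβ.1.1, ?_⟩⟩
  have := hβ.2.trans hα.2.symm
  exact e.injective (ToType.mk.symm.injective (Subtype.ext this))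

theorem StationaryIn.exists_fiber_of_mapsTo {κ : Cardinal.{u}} (hκ : κ.IsRegular) (hunc : ℵ₀ < κ)
    {S : Set Ordinal.{u}} (hS : StationaryIn κ S) {X : Type v} {Y : Set X}
    (hY : Cardinal.lift.{u} #Y < Cardinal.lift.{v} κ) (f : Ordinal.{u} → X)
    (hf : ∀ α ∈ S, α < κ.ord → f α ∈ Y) : ∃ x ∈ Y, StationaryIn κ {α ∈ S | f α = x} := by
  classical
  have hS' := (isClubIn_Ioo hκ hκ.ord_pos).stationaryIn_inter hκ hunc hS
  obtain ⟨α₀, hα₀, -⟩ := hS' _ (isClubIn_Ioo hκ hκ.ord_pos)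
  obtain ⟨x, hx⟩ := hS'.exists_fiber_of_small hκ hunc hY
    (fun α => if h : f α ∈ Y then ⟨f α, h⟩ else ⟨f α₀, hf α₀ hα₀.1 hα₀.2.2⟩)
  refine ⟨x, x.2, hx.mono fun α hα => ⟨hα.1.1, ?_⟩⟩
  have := hα.2
  rw [dif_pos (hf α hα.1.1 hα.1.2.2)] at this
  exact congrArg Subtype.val this

/-! ### Limit points and largest elements. -/

theorem IsLimitPoint.mono {α : Ordinal.{u}} {C D : Set Ordinal.{u}} (h : IsLimitPoint α C)
    (hCD : ∀ γ ∈ C, γ < α → γ ∈ D) : IsLimitPoint α D :=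
  ⟨h.1, fun β hβ =>
    let ⟨γ, hγ, h1, h2⟩ := h.2 β hβ
    ⟨γ, hCD γ hγ h2, h1, h2⟩⟩

theorem IsLimitPoint.add_one_lt {α : Ordinal.{u}} {C : Set Ordinal.{u}} (h : IsLimitPoint α C)
    {β : Ordinal.{u}} (hβ : β < α) : β + 1 < α := by
  obtain ⟨γ, -, h1, h2⟩ := h.2 β hβ
  exact (Order.add_one_le_iff.2 h1).trans_lt h2

theorem IsLimitPoint.mem_accPoints_Iio {α o : Ordinal.{u}} {C : Set Ordinal.{u}}
    (h : IsLimitPoint α C) (ho : α < o) : α ∈ accPoints (Set.Iio o) :=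
  ⟨ho, h.mono fun _ _ h => h.trans ho⟩

theorem IsClubIn.isLimitPoint {α : Ordinal.{u}} {C D : Set Ordinal.{u}} (h : IsClubIn C α)
    (hα : IsLimitPoint α D) : IsLimitPoint α C :=
  ⟨hα.1, fun β hβ =>
    let ⟨γ, hγ, h1⟩ := h.unbounded _ (hα.add_one_lt hβ)
    ⟨γ, hγ, (lt_add_one β).trans_le h1, h.subset hγ⟩⟩

/-- The supremum of C ∩ δ lies below δ; if it were not attained, it would be a limit point of C and
closedness would put it in C. -/
theorem exists_max_of_not_isLimitPoint {C : Set Ordinal.{u}} {δ : Ordinal.{u}}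
    (hcl : ∀ β < δ, IsLimitPoint β C → β ∈ C) (hne : ∃ γ ∈ C, γ < δ) (hδ : ¬ IsLimitPoint δ C) :
    ∃ s ∈ C, s < δ ∧ ∀ γ ∈ C, γ < δ → γ ≤ s := by
  obtain ⟨γ₀, hγ₀, hγ₀δ⟩ := hne
  have hδ0 : δ ≠ 0 := ((zero_le (a := γ₀)).trans_lt hγ₀δ).ne'
  have : ∃ β < δ, ∀ γ ∈ C, γ < δ → γ ≤ β := by
    by_contra! h
    exact hδ ⟨hδ0, fun β hβ =>
      let ⟨γ, h1, h2, h3⟩ := h β hβ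
      ⟨γ, h1, h3, h2⟩⟩
  obtain ⟨β, hβδ, hβ⟩ := this
  let U : Set Ordinal.{u} := {b | ∀ γ ∈ C, γ < δ → γ ≤ b}
  have hU : U.Nonempty := ⟨β, hβ⟩
  have hs : sInf U ∈ U := csInf_mem hU
  have hsδ : sInf U < δ := (csInf_le' (show β ∈ U from hβ)).trans_lt hβδ
  refine ⟨sInf U, ?_, hsδ, hs⟩
  by_contra hsC
  refine hsC (hcl _ hsδ ⟨fun h0 => ?_, fun b hb => ?_⟩)
  · have := hs γ₀ hγ₀ hγ₀δ
    rw [h0] at this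
    rw [h0, ← le_antisymm this zero_le] at hsC
    exact hsC hγ₀
  · have : b ∉ U := notMem_of_lt_csInf' hb
    simp only [U, Set.mem_ofPred_eq, not_forall, not_le] at this
    obtain ⟨γ, h1, h2, h3⟩ := this
    exact ⟨γ, h1, h3, (hs γ h1 h2).lt_of_ne fun h => hsC (h ▸ h1)⟩

/-! ### Traces of a square sequence and the colouring. -/

/-- The traces on `δ` of the members of `C` that lie above `δ`. -/
def initialSegments (κ : Cardinal.{u}) (C : Ordinal.{u} → Set Ordinal.{u}) (δ : Ordinal.{u}) :
    Set (Set Ordinal.{u}) :=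
  {y | ∃ α ∈ accPoints (Set.Iio κ.ord), δ ≤ α ∧ C α ∩ Set.Iio δ = y}

/-- Induction on δ: a trace on δ is empty, or is C_δ by coherence, or has a largest element s and is
then determined by s and its trace on s. -/
theorem IsSquareSeq.mk_initialSegments_lt {κ : Cardinal.{u}} (hκ : κ.IsRegular)
    {C : Ordinal.{u} → Set Ordinal.{u}} (hC : IsSquareSeq κ C) {δ : Ordinal.{u}}
    (hδ : δ < κ.ord) : #(initialSegments κ C δ) < Cardinal.lift.{u + 1} κ := by
  induction δ using WellFoundedLT.induction with
  | _ δ ih =>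
  have hreg : (Cardinal.lift.{u + 1} κ).IsRegular := hκ.lift
  have hsub : initialSegments κ C δ ⊆ insert ∅ (insert (C δ)
      (⋃ s : Set.Iio δ, (fun x => insert s.1 x) '' initialSegments κ C s.1)) := by
    rintro y ⟨α, hα, hδα, rfl⟩
    have hclub := hC.club α hα
    by_cases hlim : IsLimitPoint δ (C α)
    · right; left
      rcases hδα.eq_or_lt with rfl | hlt
      · exact Set.inter_eq_left.2 hclub.subset
      · exact hC.coherent δ (hlim.mem_accPoints_Iio hδ) α hα ⟨hclub.closed δ hlt hlim, hlim⟩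
    · by_cases hne : ∃ γ ∈ C α, γ < δ
      · obtain ⟨s, hs, hsδ, hmax⟩ := exists_max_of_not_isLimitPoint
          (fun β hβ h => hclub.closed β (hβ.trans_le hδα) h) hne hlim
        right; right
        refine Set.mem_iUnion.2 ⟨⟨s, hsδ⟩, C α ∩ Set.Iio s, ⟨α, hα, hsδ.le.trans hδα, rfl⟩, ?_⟩
        ext γ
        simp only [Set.mem_insert_iff, Set.mem_inter_iff, Set.mem_Iio]
        constructor
        · rintro (rfl | ⟨h1, h2⟩)
          · exact ⟨hs, hsδ⟩
          · exact ⟨h1, h2.trans hsδ⟩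
        · rintro ⟨h1, h2⟩
          rcases (hmax γ h1 h2).eq_or_lt with h | h
          · exact Or.inl h
          · exact Or.inr ⟨h1, h⟩
      · left
        ext γ
        simp only [Set.mem_inter_iff, Set.mem_Iio, Set.mem_empty_iff_false, iff_false]
        exact fun h => hne ⟨γ, h.1, h.2⟩
  refine (Cardinal.mk_le_mk_of_subset hsub).trans_lt ?_
  have hU : #(⋃ s : Set.Iio δ, (fun x => insert s.1 x) '' initialSegments κ C s.1 :
      Set (Set Ordinal.{u})) < Cardinal.lift.{u + 1} κ := by
    rw [card_iUnion_lt_iff_forall_of_isRegular hreg]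
    · exact fun s => Cardinal.mk_image_le.trans_lt (ih s.1 s.2 (s.2.trans hδ))
    · rw [Cardinal.mk_Iio_ordinal, Cardinal.lift_lt]
      exact Cardinal.lt_ord.1 hδ
  have h1 : (1 : Cardinal) < Cardinal.lift.{u + 1} κ := one_lt_aleph0.trans_le hreg.aleph0_le
  exact Cardinal.mk_insert_le.trans_lt (Cardinal.add_lt_of_lt hreg.aleph0_le
    (Cardinal.mk_insert_le.trans_lt (Cardinal.add_lt_of_lt hreg.aleph0_le hU h1)) h1)

/-- A stationary set is split into stationary pieces by the traces of the square sequence. -/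
theorem IsSquareSeq.exists_split {κ : Cardinal.{u}} (hκ : κ.IsRegular) (hunc : ℵ₀ < κ)
    {C : Ordinal.{u} → Set Ordinal.{u}} (hC : IsSquareSeq κ C) {S : Set Ordinal.{u}}
    (hS : StationaryIn κ S) (hSlim : S ⊆ accPoints (Set.Iio κ.ord)) :
    ∃ δ < κ.ord, ∀ z, StationaryIn κ {α ∈ S | C α ∩ Set.Iio δ ≠ z} := by
  by_contra! hcon
  have : ∀ δ, ∃ z E, δ < κ.ord → IsClubIn E κ.ord ∧ ∀ α ∈ S, α ∈ E → C α ∩ Set.Iio δ = z := by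
    intro δ
    by_cases hδ : δ < κ.ord
    · obtain ⟨z, hz⟩ := hcon δ hδ
      simp only [StationaryIn, not_forall] at hz
      obtain ⟨E, hE, h⟩ := hz
      exact ⟨z, E, fun _ => ⟨hE, fun α hα hαE => by
        by_contra hne
        exact h ⟨α, ⟨hα, hne⟩, hαE⟩⟩⟩
    · exact ⟨∅, ∅, fun h => absurd h hδ⟩
  choose z E hE using this
  have hboth : ∀ {S'}, StationaryIn κ S' → S' ⊆ S → ∀ {δ δ'}, δ < κ.ord → δ' < κ.ord →
      ∃ α ∈ S', δ < α ∧ C α ∩ Set.Iio δ = z δ ∧ C α ∩ Set.Iio δ' = z δ' := by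
    intro S' hS' hsub δ δ' hδ hδ'
    obtain ⟨α, ⟨⟨hα, h1⟩, h2⟩, h3⟩ := ((hE δ' hδ').1.stationaryIn_inter hκ hunc
      ((hE δ hδ).1.stationaryIn_inter hκ hunc hS')) _ (isClubIn_Ioo hκ hδ)
    exact ⟨α, hα, h3.1, (hE δ hδ).2 α (hsub hα) h1, (hE δ' hδ').2 α (hsub hα) h2⟩
  -- The stable traces z δ are initial segments of one another; D is their union and turns out to be
  -- a thread.
  let D : Set Ordinal.{u} := {γ | γ < κ.ord ∧ γ ∈ z (γ + 1)}
  have hDz : ∀ {δ}, δ < κ.ord → D ∩ Set.Iio δ = z δ := by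
    intro δ hδ
    ext γ
    constructor
    · rintro ⟨⟨h1, h2⟩, h3⟩
      obtain ⟨α, -, -, h4, h5⟩ := hboth hS subset_rfl hδ (add_one_lt_ord hκ h1)
      rw [← h4]
      rw [← h5] at h2
      exact ⟨h2.1, h3⟩
    · intro h
      obtain ⟨α', -, -, h6, -⟩ := hboth hS subset_rfl hδ hδ
      have hγδ : γ < δ := by rw [← h6] at h; exact h.2
      obtain ⟨α, -, -, h4, h5⟩ := hboth hS subset_rfl hδ (add_one_lt_ord hκ (hγδ.trans hδ))
      refine ⟨⟨hγδ.trans hδ, ?_⟩, hγδ⟩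
      rw [← h5]
      rw [← h4] at h
      exact ⟨h.1, lt_add_one γ⟩
  have htrace : ∀ {δ}, δ < κ.ord → ∃ α ∈ S, δ + 1 < α ∧ ∀ γ ≤ δ, γ ∈ C α ↔ γ ∈ D := by
    intro δ hδ
    have hδ' := add_one_lt_ord hκ hδ
    obtain ⟨α, hα, h1, h2, -⟩ := hboth hS subset_rfl hδ' hδ'
    refine ⟨α, hα, h1, fun γ hγ => ?_⟩
    have hγ' : γ ∈ Set.Iio (δ + 1) := Order.lt_add_one_iff.2 hγ
    have := Set.ext_iff.1 (h2.trans (hDz hδ').symm) γ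
    simpa [hγ'] using this
  refine hC.no_thread ⟨D, ⟨fun γ h => h.1, fun β hβ hlim => ?_, fun β hβ => ?_⟩, fun α hα => ?_⟩
  · obtain ⟨α, hα, h1, h2⟩ := htrace hβ
    exact (h2 β le_rfl).1 ((hC.club α (hSlim hα)).closed β ((lt_add_one β).trans h1)
      (hlim.mono fun γ hγ hγβ => (h2 γ hγβ.le).2 hγ))
  -- Choosing a point of C α beyond β is regressive, so by Fodor's lemma one γ works stationarily
  -- often and therefore belongs to D.
  · have hN : ∀ α, ∃ γ, α ∈ S ∩ Set.Ioo β κ.ord → γ ∈ C α ∧ β ≤ γ := by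
      intro α
      by_cases h : α ∈ S ∩ Set.Ioo β κ.ord
      · obtain ⟨γ, h1, h2⟩ := (hC.club α (hSlim h.1)).unbounded β h.2.1
        exact ⟨γ, fun _ => ⟨h1, h2⟩⟩
      · exact ⟨0, fun h' => absurd h' h⟩
    choose N hN using hN
    have hS' := (isClubIn_Ioo hκ hβ).stationaryIn_inter hκ hunc hS
    obtain ⟨γ, hγ, h⟩ := hS'.exists_fiber hκ hunc N
      (fun α hα _ => (hC.club α (hSlim hα.1)).subset (hN α hα).1)
    have hγ' := add_one_lt_ord hκ hγ
    obtain ⟨α, hα, -, h1, -⟩ := hboth h (fun α hα => hα.1.1) hγ' hγ'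
    have hm := hN α hα.1
    rw [hα.2] at hm
    have : γ ∈ z (γ + 1) := by rw [← h1]; exact ⟨hm.1, lt_add_one γ⟩
    exact ⟨γ, ⟨hγ, this⟩, hm.2⟩
  · obtain ⟨α', hα', h1, h2⟩ := htrace hα.1.1
    have hlim : IsLimitPoint α (C α') := hα.2.mono fun γ hγ hγα => (h2 γ hγα.le).2 hγ
    rw [← hC.coherent α (hlim.mem_accPoints_Iio hα.1.1) α' (hSlim hα') ⟨(h2 α le_rfl).2 hα.1, hlim⟩]
    ext γ
    simp only [Set.mem_inter_iff, Set.mem_Iio]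
    exact ⟨fun h => ⟨(h2 γ h.2.le).2 h.1, h.2⟩, fun h => ⟨(h2 γ h.2.le).1 h.1, h.2⟩⟩

/-- There are fewer than κ traces y on δ, so the splitting points obtained for each of them have a
common bound below κ. -/
theorem IsSquareSeq.exists_uniform_split {κ : Cardinal.{u}} (hκ : κ.IsRegular) (hunc : ℵ₀ < κ)
    {C : Ordinal.{u} → Set Ordinal.{u}} (hC : IsSquareSeq κ C) {S : Set Ordinal.{u}}
    (hSlim : S ⊆ accPoints (Set.Iio κ.ord)) {δ : Ordinal.{u}} (hδ : δ < κ.ord) :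
    ∃ δ' < κ.ord, δ < δ' ∧ ∀ y, StationaryIn κ {α ∈ S | C α ∩ Set.Iio δ = y} →
      ∀ z, StationaryIn κ {α ∈ S | C α ∩ Set.Iio δ = y ∧ C α ∩ Set.Iio δ' ≠ z} := by
  have : ∀ y : initialSegments κ C δ, ∃ ε < κ.ord,
      StationaryIn κ {α ∈ S | C α ∩ Set.Iio δ = y.1} →
      ∀ z, StationaryIn κ {α ∈ S | C α ∩ Set.Iio δ = y.1 ∧ C α ∩ Set.Iio ε ≠ z} := by
    intro y
    by_cases h : StationaryIn κ {α ∈ S | C α ∩ Set.Iio δ = y.1}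
    · obtain ⟨ε, hε, h'⟩ := hC.exists_split hκ hunc h fun α hα => hSlim hα.1
      exact ⟨ε, hε, fun _ z => (h' z).mono fun α hα => ⟨hα.1.1, hα.1.2, hα.2⟩⟩
    · exact ⟨0, hκ.ord_pos, fun h' => absurd h' h⟩
  choose g hg hg' using this
  obtain ⟨b, hb, hgb⟩ := exists_bound_of_lt_cof (by
    rw [hκ.cof_ord, Cardinal.lift_id'.{u, u + 1}]
    exact hC.mk_initialSegments_lt hκ hδ) g hg
  refine ⟨max b (δ + 1), max_lt hb (add_one_lt_ord hκ hδ),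
    (lt_add_one δ).trans_le (le_max_right _ _), fun y hy z => ?_⟩
  obtain ⟨α, hα, h1, h2⟩ := hy.exists_gt hκ hδ
  let y' : initialSegments κ C δ := ⟨y, α, hSlim hα.1, h1.le, hα.2⟩
  refine (hg' y' hy (z ∩ Set.Iio (g y'))).mono fun β hβ => ⟨hβ.1, hβ.2.1, fun h => hβ.2.2 ?_⟩
  rw [← h, Set.inter_assoc, Set.Iio_inter_Iio,
    min_eq_right ((hgb y').le.trans (le_max_left _ _))]

/-- The sequence obtained by iterating `g` transfinitely, taking suprema at every stage. -/
noncomputable def iterateSup (g : Ordinal.{u} → Ordinal.{u}) (ξ : Ordinal.{u}) : Ordinal.{u} :=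
  ⨆ ζ : Set.Iio ξ, g (iterateSup g ζ.1)
termination_by ξ
decreasing_by exact ζ.2

theorem le_iterateSup (g : Ordinal.{u} → Ordinal.{u}) {ζ ξ : Ordinal.{u}} (h : ζ < ξ) :
    g (iterateSup g ζ) ≤ iterateSup g ξ := by
  conv_rhs => rw [iterateSup]
  exact le_ciSup (f := fun ζ : Set.Iio ξ => g (iterateSup g ζ.1)) bddAbove_of_small ⟨ζ, h⟩

theorem iterateSup_lt_ord {κ : Cardinal.{u}} (hκ : κ.IsRegular) {g : Ordinal.{u} → Ordinal.{u}}
    (hg : ∀ α < κ.ord, g α < κ.ord) {ξ : Ordinal.{u}} (hξ : ξ < κ.ord) :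
    iterateSup g ξ < κ.ord := by
  induction ξ using WellFoundedLT.induction with
  | _ ξ ih =>
  obtain ⟨b, hb, h⟩ := exists_bound_of_lt_ord hκ hξ (fun ζ => g (iterateSup g ζ))
    fun ζ hζ => hg _ (ih ζ hζ (hζ.trans hξ))
  rw [iterateSup]
  exact (ciSup_le' fun ζ : Set.Iio ξ => (h ζ.1 ζ.2).le).trans_lt hb

theorem StationaryIn.exists_trace {κ : Cardinal.{u}} (hκ : κ.IsRegular) (hunc : ℵ₀ < κ)
    {C : Ordinal.{u} → Set Ordinal.{u}} (hC : IsSquareSeq κ C) {S : Set Ordinal.{u}}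
    (hS : StationaryIn κ S) (hSlim : S ⊆ accPoints (Set.Iio κ.ord)) {δ : Ordinal.{u}}
    (hδ : δ < κ.ord) : ∃ y, StationaryIn κ {α ∈ S | C α ∩ Set.Iio δ = y} := by
  obtain ⟨y, -, h⟩ := ((isClubIn_Ioo hκ hδ).stationaryIn_inter hκ hunc hS).exists_fiber_of_mapsTo
    hκ hunc (Y := initialSegments κ C δ) (by
      rw [Cardinal.lift_id'.{u, u + 1}]
      exact hC.mk_initialSegments_lt hκ hδ) (fun α => C α ∩ Set.Iio δ)
    (fun α hα _ => ⟨α, hSlim hα.1, hα.2.1.le, rfl⟩)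
  exact ⟨y, h.mono fun α hα => ⟨hα.1.1, hα.2⟩⟩

/-- From a square sequence one obtains a coherent club sequence and a colouring with `l` colours
that is constant along the sequence and takes large colours stationarily often. -/
theorem IsSquareSeq.exists_coloring {κ l : Cardinal.{u}} (hκ : κ.IsRegular) (hunc : ℵ₀ < κ)
    {C : Ordinal.{u} → Set Ordinal.{u}} (hC : IsSquareSeq κ C) (hl : l.IsRegular) (hlκ : l < κ)
    {S : Set Ordinal.{u}} (hS : StationaryIn κ S) (hSlim : S ⊆ accPoints (Set.Iio κ.ord)) :
    ∃ (C' : Ordinal.{u} → Set Ordinal.{u}) (h : Ordinal.{u} → Ordinal.{u}),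
      (∀ α ∈ accPoints (Set.Iio κ.ord), IsClubIn (C' α) α) ∧
      (∀ α ∈ accPoints (Set.Iio κ.ord), ∀ β ∈ accPoints (Set.Iio κ.ord),
        α ∈ accPoints (C' β) → C' β ∩ Set.Iio α = C' α ∧ h α = h β) ∧
      (∀ α, h α < l.ord) ∧ ∀ i < l.ord, StationaryIn κ {α ∈ S | i < h α} := by
  classical
  have hsplit : ∀ δ, ∃ δ', δ < κ.ord → δ' < κ.ord ∧ δ < δ' ∧
      ∀ y, StationaryIn κ {α ∈ S | C α ∩ Set.Iio δ = y} →
        ∀ z, StationaryIn κ {α ∈ S | C α ∩ Set.Iio δ = y ∧ C α ∩ Set.Iio δ' ≠ z} := by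
    intro δ
    by_cases hδ : δ < κ.ord
    · obtain ⟨δ', h⟩ := hC.exists_uniform_split hκ hunc hSlim hδ
      exact ⟨δ', fun _ => h⟩
    · exact ⟨0, fun h => absurd h hδ⟩
  choose g hg using hsplit
  have hlκ' : l.ord < κ.ord := Cardinal.ord_lt_ord.2 hlκ
  let d := iterateSup g
  have hd : ∀ {ξ}, ξ < κ.ord → d ξ < κ.ord :=
    fun hξ => iterateSup_lt_ord hκ (fun α hα => (hg α hα).1) hξ
  have hdmono : ∀ {ζ ξ}, ζ ≤ ξ → ξ < κ.ord → d ζ ≤ d ξ := by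
    intro ζ ξ h hξ
    rcases h.eq_or_lt with rfl | h
    · exact le_rfl
    · exact (hg _ (hd (h.trans hξ))).2.1.le.trans (le_iterateSup g h)
  let δ := d l.ord
  have hδ : δ < κ.ord := hd hlκ'
  obtain ⟨y, hy⟩ := hS.exists_trace hκ hunc hC hSlim hδ
  -- The colour is the first stage at which a trace departs from y; it is 0 if this never happens,
  -- by the value of `sInf ∅`.
  let c : Set Ordinal.{u} → Ordinal.{u} := fun X =>
    sInf {ξ | ξ < l.ord ∧ X ∩ Set.Iio (d ξ) ≠ y ∩ Set.Iio (d ξ)}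
  have hc : ∀ X, c X < l.ord := by
    intro X
    rcases Set.eq_empty_or_nonempty {ξ | ξ < l.ord ∧ X ∩ Set.Iio (d ξ) ≠ y ∩ Set.Iio (d ξ)}
      with h | h
    · simp only [c, h, Ordinal.sInf_empty]
      exact hl.ord_pos
    · exact (csInf_mem h).1
  -- Removing the points up to δ from C β when β > δ forces its limit points above δ, so they share
  -- the trace of β on δ and hence its colour.
  refine ⟨fun β => {x ∈ C β | δ < β → δ < x}, fun α => if δ < α then c (C α ∩ Set.Iio δ) else 0,
    fun α hα => ?_, fun α hα β hβ hαβ => ?_, fun α => ?_, fun i hi => ?_⟩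
  · have hclub := hC.club α hα
    refine ⟨fun x hx => hclub.subset hx.1, fun β hβ hlim => ⟨hclub.closed β hβ
      (hlim.mono fun _ h _ => h.1), fun h => ?_⟩, fun β hβ => ?_⟩
    · obtain ⟨γ, hγ, -, h2⟩ := hlim.2 0 (pos_iff_ne_zero.2 hlim.1)
      exact (hγ.2 h).trans h2
    · by_cases h : δ < α
      · obtain ⟨γ, hγ, h1⟩ := hclub.unbounded _ (hα.2.add_one_lt (max_lt hβ h))
        have h2 := (lt_add_one _).trans_le h1
        exact ⟨γ, ⟨hγ, fun _ => (le_max_right _ _).trans_lt h2⟩,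
          ((le_max_left _ _).trans_lt h2).le⟩
      · obtain ⟨γ, hγ, h1⟩ := hclub.unbounded _ hβ
        exact ⟨γ, ⟨hγ, fun h' => absurd h' h⟩, h1⟩
  · have hlt : α < β := (hC.club β hβ).subset hαβ.1.1
    have hiff : δ < β ↔ δ < α := ⟨hαβ.1.2, fun h => h.trans hlt⟩
    have heq := hC.coherent α hα β hβ ⟨hαβ.1.1, hαβ.2.mono fun _ h _ => h.1⟩
    constructor
    · ext x
      simp only [Set.mem_inter_iff, Set.mem_ofPred_eq, Set.mem_Iio, ← heq, hiff]
      tauto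
    · simp only [hiff, ← heq]
      split_ifs with h
      · rw [Set.inter_assoc, Set.Iio_inter_Iio, min_eq_right h.le]
      · rfl
  · dsimp only
    split_ifs
    · exact hc _
    · exact hl.ord_pos
  · have hi1 : i + 1 < l.ord := add_one_lt_ord hl hi
    have hiκ : i < κ.ord := hi.trans hlκ'
    -- Splitting this stationary set gives traces that agree with y up to d i but differ from it
    -- below g (d i) ≤ d (i + 1), hence have a colour above i.
    have hst : StationaryIn κ {α ∈ S | C α ∩ Set.Iio (d i) = y ∩ Set.Iio (d i)} :=
      hy.mono fun α hα => ⟨hα.1, by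
        rw [← hα.2, Set.inter_assoc, Set.Iio_inter_Iio, min_eq_right (hdmono hi.le hlκ')]⟩
    refine ((isClubIn_Ioo hκ hδ).stationaryIn_inter hκ hunc ((hg _ (hd hiκ)).2.2 _ hst
      (y ∩ Set.Iio (g (d i))))).mono ?_
    rintro α ⟨⟨hα, h1, h2⟩, h3, -⟩
    refine ⟨hα, ?_⟩
    dsimp only
    rw [if_pos h3]
    have hgd : g (d i) ≤ d (i + 1) := le_iterateSup g (lt_add_one i)
    have hcut : ∀ {ξ}, ξ ≤ l.ord → C α ∩ Set.Iio δ ∩ Set.Iio (d ξ) = C α ∩ Set.Iio (d ξ) := by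
      intro ξ hξ
      rw [Set.inter_assoc, Set.Iio_inter_Iio, min_eq_right (hdmono hξ hlκ')]
    have hne : {ξ | ξ < l.ord ∧ C α ∩ Set.Iio δ ∩ Set.Iio (d ξ) ≠ y ∩ Set.Iio (d ξ)}.Nonempty := by
      refine ⟨i + 1, hi1, fun h => h2 ?_⟩
      rw [hcut hi1.le] at h
      have := congrArg (· ∩ Set.Iio (g (d i))) h
      simpa only [Set.inter_assoc, Set.Iio_inter_Iio, min_eq_right hgd] using this
    obtain ⟨h4, h5⟩ := csInf_mem hne
    by_contra! hle
    refine h5 ?_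
    rw [hcut h4.le]
    have : C α ∩ Set.Iio (d i) ∩ Set.Iio (d (c (C α ∩ Set.Iio δ))) =
        y ∩ Set.Iio (d i) ∩ Set.Iio (d (c (C α ∩ Set.Iio δ))) := by rw [h1]
    rwa [Set.inter_assoc, Set.inter_assoc, Set.Iio_inter_Iio,
      min_eq_right (hdmono hle hiκ)] at this

/-! ### Ladders of order type ω. -/

/-- Each step of the sequence passes a point of D. A supremum below β would thus be a limit point of
D above a. -/
theorem exists_cofinal_sequence {β a : Ordinal.{u}} {D : Set Ordinal.{u}} {P : Ordinal.{u} → Prop}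
    (hβ : ∀ x < β, x + 1 < β) (hD : IsClubIn D β) (hP : ∀ x < β, ∃ y, x ≤ y ∧ y < β ∧ P y)
    (ha : a < β) (haP : P a) (hacc : ∀ α ∈ accPoints D, α ≤ a) :
    ∃ f : ℕ → Ordinal.{u}, StrictMono f ∧ f 0 = a ∧ (∀ n, f n < β) ∧ (∀ n, P (f n)) ∧
      ∀ α < β, ∃ n, α ≤ f n := by
  have hstep : ∀ x : {x // x < β ∧ P x}, ∃ y : {x // x < β ∧ P x},
      ∃ c ∈ D, x.1 < c ∧ c ≤ y.1 := by
    rintro ⟨x, hx, -⟩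
    obtain ⟨c, hc, hxc⟩ := hD.unbounded _ (hβ x hx)
    obtain ⟨y, hcy, hy, hPy⟩ := hP c (hD.subset hc)
    exact ⟨⟨y, hy, hPy⟩, c, hc, (lt_add_one x).trans_le hxc, hcy⟩
  choose g c hc hgc hcg using hstep
  let F : ℕ → {x // x < β ∧ P x} := fun n => g^[n] ⟨a, ha, haP⟩
  have hF : ∀ n, F (n + 1) = g (F n) := fun n => Function.iterate_succ_apply' g n _
  have hmono : StrictMono fun n => (F n).1 := strictMono_nat_of_lt_succ fun n => by
    rw [hF]
    exact (hgc _).trans_le (hcg _)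
  refine ⟨fun n => (F n).1, hmono, rfl, fun n => (F n).2.1, fun n => (F n).2.2, ?_⟩
  by_contra! hcon
  obtain ⟨α, hα, hFα⟩ := hcon
  let s := ⨆ n, (F n).1
  have hlt : ∀ n, (F n).1 < s := fun n => (hmono (Nat.lt_succ_self n)).trans_le
    (le_ciSup (f := fun n => (F n).1) bddAbove_of_small (n + 1))
  have hsβ : s < β := (ciSup_le' fun n => (hFα n).le).trans_lt hα
  have hlim : IsLimitPoint s D := by
    refine ⟨(zero_le.trans_lt (hlt 0)).ne', fun b hb => ?_⟩
    obtain ⟨n, hn⟩ := exists_lt_of_lt_ciSup' hb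
    refine ⟨c (F n), hc _, hn.trans (hgc _), ?_⟩
    have := hcg (F n)
    rw [← hF] at this
    exact this.trans_lt (hlt _)
  exact (hlt 0).not_ge (hacc s ⟨hD.closed s hsβ hlim, hlim⟩)

theorem exists_max_accPoints {C : Set Ordinal.{u}} {β : Ordinal.{u}}
    (hcl : ∀ γ < β, IsLimitPoint γ C → γ ∈ C) (hb : ¬ IsLimitPoint β (accPoints C))
    (hne : ∃ γ ∈ accPoints C, γ < β) :
    ∃ s ∈ accPoints C, s < β ∧ ∀ γ ∈ accPoints C, γ < β → γ ≤ s :=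
  exists_max_of_not_isLimitPoint (fun γ hγ h =>
    have h' : IsLimitPoint γ C := h.mono fun _ h _ => h.1
    ⟨hcl γ hγ h', h'⟩) hne hb

/-- The ladder starts at the largest element of acc(D), if there is one. When limit ordinals are
cofinal in β, all rungs are limits; otherwise the ladder need only reach the last limit ordinal
below β through limit rungs, and its later rungs are arbitrary. -/
theorem exists_ladder {o β : Ordinal.{u}} {D : Set Ordinal.{u}} (hβ : β ∈ accPoints (Set.Iio o))
    (hD : IsClubIn D β) (hb : ¬ IsLimitPoint β (accPoints D)) :
    ∃ f : ℕ → Ordinal.{u}, StrictMono f ∧ (∀ n, f n < β) ∧ (∀ α < β, ∃ n, α ≤ f n) ∧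
      (∀ α ∈ accPoints D, f 0 ∈ accPoints D ∧ α ≤ f 0) ∧
      ∀ α ∈ accPoints (Set.Iio o), α < β → ∃ n, α ≤ f n ∧ ∀ m ≤ n, f m ∈ accPoints (Set.Iio o) := by
  have hβ' : ∀ x < β, x + 1 < β := fun x hx => hβ.2.add_one_lt hx
  have hDlim : ∀ α ∈ accPoints D, α ∈ accPoints (Set.Iio o) ∧ α < β := fun α hα =>
    ⟨hα.2.mem_accPoints_Iio ((hD.subset hα.1).trans hβ.1), hD.subset hα.1⟩
  by_cases hlim : ∃ γ ∈ accPoints (Set.Iio o), γ < β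
  · by_cases hL : IsLimitPoint β (accPoints (Set.Iio o))
    · obtain ⟨a, ha, haβ, hmax⟩ : ∃ a ∈ accPoints (Set.Iio o), a < β ∧
          ∀ α ∈ accPoints D, a ∈ accPoints D ∧ α ≤ a := by
        by_cases hne : ∃ γ ∈ accPoints D, γ < β
        · obtain ⟨s, hs, hsβ, h⟩ := exists_max_accPoints hD.closed hb hne
          exact ⟨s, (hDlim s hs).1, hsβ, fun α hα => ⟨hs, h α hα (hDlim α hα).2⟩⟩
        · obtain ⟨γ, hγ, hγβ⟩ := hlim
          exact ⟨γ, hγ, hγβ, fun α hα => absurd ⟨α, hα, (hDlim α hα).2⟩ hne⟩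
      obtain ⟨f, hf, rfl, hfβ, hfP, hcof⟩ := exists_cofinal_sequence
        (P := (· ∈ accPoints (Set.Iio o))) hβ' hD (fun x hx =>
          let ⟨γ, h1, h2, h3⟩ := hL.2 x hx
          ⟨γ, h2.le, h3, h1⟩) haβ ha fun α hα => (hmax α hα).2
      exact ⟨f, hf, hfβ, hcof, hmax, fun α _ hα =>
        let ⟨n, hn⟩ := hcof α hα
        ⟨n, hn, fun m _ => hfP m⟩⟩
    · obtain ⟨t, ht, htβ, htmax⟩ := exists_max_accPoints
        (fun γ hγ _ => hγ.trans hβ.1) hL hlim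
      obtain ⟨f, hf, hf0, hfβ, -, hcof⟩ := exists_cofinal_sequence (P := fun _ => True) hβ' hD
        (fun x hx => ⟨x, le_rfl, hx, trivial⟩) htβ trivial
        fun α hα => htmax α (hDlim α hα).1 (hDlim α hα).2
      by_cases hne : ∃ γ ∈ accPoints D, γ < β
      · obtain ⟨s, hs, hsβ, h⟩ := exists_max_accPoints hD.closed hb hne
        rcases (htmax s (hDlim s hs).1 hsβ).eq_or_lt with rfl | hst
        · refine ⟨f, hf, hfβ, hcof, fun α hα => ?_, fun α hα hαβ => ⟨0, ?_, fun m hm => ?_⟩⟩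
          · rw [hf0]
            exact ⟨hs, h α hα (hDlim α hα).2⟩
          · rw [hf0]
            exact htmax α hα hαβ
          · rw [Nat.le_zero.1 hm, hf0]
            exact ht
        -- Here the largest element s of acc(D) lies below the last limit t, so s is prepended and t
        -- becomes rung 1.
        · let f' : ℕ → Ordinal.{u} := fun n => Nat.casesOn n s f
          refine ⟨f', strictMono_nat_of_lt_succ fun n => ?_, fun n => ?_, fun α hα => ?_,
            fun α hα => ⟨hs, h α hα (hDlim α hα).2⟩, fun α hα hαβ => ⟨1, ?_, fun m hm => ?_⟩⟩
          · cases n with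
            | zero => exact hst.trans_eq hf0.symm
            | succ n => exact hf (Nat.lt_succ_self n)
          · cases n with
            | zero => exact hsβ
            | succ n => exact hfβ n
          · obtain ⟨n, hn⟩ := hcof α hα
            exact ⟨n + 1, hn⟩
          · exact (htmax α hα hαβ).trans_eq hf0.symm
          · rcases Nat.le_one_iff_eq_zero_or_eq_one.1 hm with rfl | rfl
            · exact (hDlim s hs).1
            · change f 0 ∈ _
              rw [hf0]
              exact ht
      · refine ⟨f, hf, hfβ, hcof, fun α hα => absurd ⟨α, hα, (hDlim α hα).2⟩ hne,
          fun α hα hαβ => ⟨0, ?_, fun m hm => ?_⟩⟩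
        · rw [hf0]
          exact htmax α hα hαβ
        · rw [Nat.le_zero.1 hm, hf0]
          exact ht
  · have hnone : ∀ α ∈ accPoints (Set.Iio o), ¬ α < β := fun α hα h => hlim ⟨α, hα, h⟩
    obtain ⟨f, hf, -, hfβ, -, hcof⟩ := exists_cofinal_sequence (P := fun _ => True) hβ' hD
      (fun x hx => ⟨x, le_rfl, hx, trivial⟩) (pos_iff_ne_zero.2 hβ.2.1) trivial
      fun α hα => absurd (hDlim α hα).2 (hnone α (hDlim α hα).1)
    exact ⟨f, hf, hfβ, hcof, fun α hα => absurd (hDlim α hα).2 (hnone α (hDlim α hα).1),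
      fun α hα h => absurd h (hnone α hα)⟩

/-! ### Gluing coherent clubs. -/

/-- Data for gluing the sets `N z`, `z ∈ Z`, each of which is an initial segment of the later ones,
together with a set `R` that has no limit points above `Z`. -/
structure IsChainData (β : Ordinal.{u}) (N : Ordinal.{u} → Set Ordinal.{u})
    (Z R : Set Ordinal.{u}) : Prop where
  subset : Z ⊆ R
  lt : ∀ x ∈ R, x < β
  unbounded : ∀ x < β, ∃ y ∈ R, x ≤ y
  trace : ∀ z ∈ Z, ∀ x ∈ R, x < z → x ∈ N z
  club : ∀ z ∈ Z, IsClubIn (N z) z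
  chain : ∀ z ∈ Z, ∀ z' ∈ Z, z < z' → N z = N z' ∩ Set.Iio z
  top : ∀ α < β, (∀ z ∈ Z, z < α) → ¬ IsLimitPoint α R
  limit : ∀ z ∈ Z, IsLimitPoint z (Set.Iio z)

/-- The set glued from a chain. -/
def chainUnion (N : Ordinal.{u} → Set Ordinal.{u}) (Z R : Set Ordinal.{u}) : Set Ordinal.{u} :=
  {x | x ∈ R ∨ ∃ z ∈ Z, x ∈ N z}

namespace IsChainData

variable {β : Ordinal.{u}} {N : Ordinal.{u} → Set Ordinal.{u}} {Z R : Set Ordinal.{u}}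

theorem mem_iff (H : IsChainData β N Z R) {z : Ordinal.{u}} (hz : z ∈ Z) {x : Ordinal.{u}}
    (hx : x < z) : x ∈ chainUnion N Z R ↔ x ∈ N z := by
  constructor
  · rintro (h | ⟨z', hz', h⟩)
    · exact H.trace z hz x h hx
    · rcases lt_trichotomy z z' with hlt | rfl | hlt
      · rw [H.chain z hz z' hz' hlt]
        exact ⟨h, hx⟩
      · exact h
      · rw [H.chain z' hz' z hz hlt] at h
        exact h.1
  · exact fun h => Or.inr ⟨z, hz, h⟩

theorem inter_eq (H : IsChainData β N Z R) {z : Ordinal.{u}} (hz : z ∈ Z) :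
    N z = chainUnion N Z R ∩ Set.Iio z := by
  ext x
  exact ⟨fun h => ⟨(H.mem_iff hz ((H.club z hz).subset h)).2 h, (H.club z hz).subset h⟩,
    fun h => (H.mem_iff hz h.2).1 h.1⟩

theorem mem_of_mem (H : IsChainData β N Z R) {z : Ordinal.{u}} (hz : z ∈ Z) :
    z ∈ accPoints (chainUnion N Z R) :=
  ⟨Or.inl (H.subset hz), ((H.club z hz).isLimitPoint (H.limit z hz)).mono
    fun _ h _ => Or.inr ⟨z, hz, h⟩⟩

/-- If α lay above Z, every point of N z could be replaced by z ∈ R, making α a limit point of R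
against `top`. -/
theorem exists_le (H : IsChainData β N Z R) {α : Ordinal.{u}} (hα : α < β)
    (hlim : IsLimitPoint α (chainUnion N Z R)) : ∃ z ∈ Z, α ≤ z := by
  by_contra! hcon
  refine H.top α hα hcon ⟨hlim.1, fun b hb => ?_⟩
  obtain ⟨x, hx | ⟨z, hz, hx⟩, h1, h2⟩ := hlim.2 b hb
  · exact ⟨x, hx, h1, h2⟩
  · exact ⟨z, H.subset hz, h1.trans ((H.club z hz).subset hx), hcon z hz⟩

theorem isClubIn (H : IsChainData β N Z R) : IsClubIn (chainUnion N Z R) β where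
  subset := by
    rintro x (hx | ⟨z, hz, hx⟩)
    · exact H.lt x hx
    · exact ((H.club z hz).subset hx).trans (H.lt z (H.subset hz))
  closed α hα hlim := by
    obtain ⟨z, hz, hle⟩ := H.exists_le hα hlim
    rcases hle.eq_or_lt with rfl | hlt
    · exact Or.inl (H.subset hz)
    · exact Or.inr ⟨z, hz, (H.club z hz).closed α hlt
        (hlim.mono fun x hx hxα => (H.mem_iff hz (hxα.trans hlt)).1 hx)⟩
  unbounded x hx :=
    let ⟨y, hy, h⟩ := H.unbounded x hx
    ⟨y, Or.inl hy, h⟩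

theorem accPoints_cases (H : IsChainData β N Z R) {α : Ordinal.{u}}
    (hα : α ∈ accPoints (chainUnion N Z R)) : ∃ z ∈ Z, α = z ∨ α < z ∧ α ∈ accPoints (N z) := by
  obtain ⟨z, hz, hle⟩ := H.exists_le (H.isClubIn.subset hα.1) hα.2
  refine ⟨z, hz, hle.eq_or_lt.imp_right fun hlt => ⟨hlt, (H.mem_iff hz hlt).1 hα.1,
    hα.2.mono fun x hx hxα => (H.mem_iff hz (hxα.trans hlt)).1 hx⟩⟩

theorem mem_of_mem_accPoints {z α : Ordinal.{u}} (hz : z ∈ Z) (hα : α ∈ accPoints (N z)) :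
    α ∈ accPoints (chainUnion N Z R) :=
  ⟨Or.inr ⟨z, hz, hα.1⟩, hα.2.mono fun _ h _ => Or.inr ⟨z, hz, h⟩⟩

end IsChainData

/-! ### Recursive construction of the rows. -/

/-- `Q` can be used as the row with index `β` of an indexed square sequence with index function
`h` whose rows below `β` are given by `M` and which refines the coherent sequence `C`. -/
structure IsRow (κ l : Cardinal.{u}) (h : Ordinal.{u} → Ordinal.{u})
    (C : Ordinal.{u} → Set Ordinal.{u}) (M : Ordinal.{u} → Ordinal.{u} → Set Ordinal.{u})
    (β : Ordinal.{u}) (Q : Ordinal.{u} → Set Ordinal.{u}) : Prop where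
  club : ∀ i, h β ≤ i → i < l.ord → IsClubIn (Q i) β
  mono : ∀ i j, h β ≤ i → i ≤ j → j < l.ord → Q i ⊆ Q j
  coherent : ∀ α < β, ∀ i, h β ≤ i → i < l.ord → α ∈ accPoints (Q i) →
    h α ≤ i ∧ M α i = Q i ∩ Set.Iio α
  exists_mem : ∀ α ∈ accPoints (Set.Iio κ.ord), α < β →
    ∃ i, h β ≤ i ∧ i < l.ord ∧ α ∈ accPoints (Q i)
  refines : ∀ α ∈ accPoints (C β), ∀ i, h β ≤ i → i < l.ord → α ∈ accPoints (Q i)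

theorem accPoints_mono {C D : Set Ordinal.{u}} (h : C ⊆ D) : accPoints C ⊆ accPoints D :=
  fun _ hα => ⟨h hα.1, hα.2.mono fun _ hγ _ => h hγ⟩

section Row

variable {κ l : Cardinal.{u}} {h : Ordinal.{u} → Ordinal.{u}} {C : Ordinal.{u} → Set Ordinal.{u}}
  {M : Ordinal.{u} → Ordinal.{u} → Set Ordinal.{u}} {β : Ordinal.{u}}

theorem isRow_chainUnion {Z : Ordinal.{u} → Set Ordinal.{u}} {R : Set Ordinal.{u}}
    (hM : ∀ γ ∈ accPoints (Set.Iio κ.ord), γ < β → IsRow κ l h C M γ (M γ))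
    (hZ : ∀ i, h β ≤ i → i < l.ord → ∀ z ∈ Z i, z ∈ accPoints (Set.Iio κ.ord) ∧ h z ≤ i)
    (hZmono : ∀ i j, h β ≤ i → i ≤ j → j < l.ord → Z i ⊆ Z j)
    (hdata : ∀ i, h β ≤ i → i < l.ord → IsChainData β (fun z => M z i) (Z i) R)
    (hex : ∀ α ∈ accPoints (Set.Iio κ.ord), α < β →
      ∃ i, h β ≤ i ∧ i < l.ord ∧ ∃ z ∈ Z i, α = z ∨ α ∈ accPoints (M z i))
    (href : ∀ α ∈ accPoints (C β), ∀ i, h β ≤ i → i < l.ord →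
      ∃ z ∈ Z i, α = z ∨ α ∈ accPoints (M z i)) :
    IsRow κ l h C M β fun i => chainUnion (fun z => M z i) (Z i) R := by
  have hacc : ∀ i, h β ≤ i → i < l.ord → ∀ α, (∃ z ∈ Z i, α = z ∨ α ∈ accPoints (M z i)) →
      α ∈ accPoints (chainUnion (fun z => M z i) (Z i) R) := by
    rintro i hi hil α ⟨z, hz, rfl | hα⟩
    · exact (hdata i hi hil).mem_of_mem hz
    · exact IsChainData.mem_of_mem_accPoints (N := fun z => M z i) hz hα
  have hlt : ∀ i, h β ≤ i → i < l.ord → ∀ z ∈ Z i, z < β := fun i hi hil z hz =>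
    (hdata i hi hil).lt z ((hdata i hi hil).subset hz)
  refine ⟨fun i hi hil => (hdata i hi hil).isClubIn, fun i j hi hij hj => ?_,
    fun α hαβ i hi hil hα => ?_, fun α hα hαβ => ?_,
    fun α hα i hi hil => hacc i hi hil α (href α hα i hi hil)⟩
  · rintro x (hx | ⟨z, hz, hx⟩)
    · exact Or.inl hx
    · have hil := hij.trans_lt hj
      exact Or.inr ⟨z, hZmono i j hi hij hj hz,
        (hM z (hZ i hi hil z hz).1 (hlt i hi hil z hz)).mono i j (hZ i hi hil z hz).2 hij hj hx⟩
  · have H := hdata i hi hil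
    obtain ⟨z, hz, rfl | ⟨hαz, hαM⟩⟩ := H.accPoints_cases hα
    · exact ⟨(hZ i hi hil _ hz).2, H.inter_eq hz⟩
    · obtain ⟨h1, h2⟩ := (hM z (hZ i hi hil z hz).1 (hlt i hi hil z hz)).coherent α hαz i
        (hZ i hi hil z hz).2 hil hαM
      refine ⟨h1, h2.trans ?_⟩
      have h3 : M z i = chainUnion (fun z => M z i) (Z i) R ∩ Set.Iio z := H.inter_eq hz
      rw [h3, Set.inter_assoc, Set.Iio_inter_Iio, min_eq_right hαz.le]
  · obtain ⟨i, hi, hil, hz⟩ := hex α hα hαβ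
    exact ⟨i, hi, hil, hacc i hi hil α hz⟩

theorem isLimitPoint_Iio {α o : Ordinal.{u}} (hα : α ∈ accPoints (Set.Iio o)) :
    IsLimitPoint α (Set.Iio α) :=
  hα.2.mono fun _ _ h => h

/-- The rows at points of acc(C_β) all have the index of β, and by `refines` they extend one another
at every level, so their unions form the new row. -/
theorem exists_isRow_of_isLimitPoint (hβ : β ∈ accPoints (Set.Iio κ.ord))
    (hC : ∀ α ∈ accPoints (Set.Iio κ.ord), IsClubIn (C α) α)
    (hcoh : ∀ α ∈ accPoints (Set.Iio κ.ord), ∀ β ∈ accPoints (Set.Iio κ.ord),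
        α ∈ accPoints (C β) → C β ∩ Set.Iio α = C α ∧ h α = h β)
    (hM : ∀ γ ∈ accPoints (Set.Iio κ.ord), γ < β → IsRow κ l h C M γ (M γ))
    (hlim : IsLimitPoint β (accPoints (C β))) : ∃ Q, IsRow κ l h C M β Q := by
  have hlt : ∀ z ∈ accPoints (C β), z < β := fun z hz => (hC β hβ).subset hz.1
  have hZ : ∀ z ∈ accPoints (C β), z ∈ accPoints (Set.Iio κ.ord) := fun z hz =>
    hz.2.mem_accPoints_Iio ((hlt z hz).trans hβ.1)
  have hh : ∀ z ∈ accPoints (C β), h z = h β := fun z hz => (hcoh z (hZ z hz) β hβ hz).2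
  have hrow : ∀ z ∈ accPoints (C β), IsRow κ l h C M z (M z) := fun z hz =>
    hM z (hZ z hz) (hlt z hz)
  have hmem : ∀ z ∈ accPoints (C β), ∀ x ∈ accPoints (C β), x < z → ∀ i, h β ≤ i → i < l.ord →
      x ∈ accPoints (M z i) := by
    intro z hz x hx hxz i hi hil
    refine (hrow z hz).refines x ?_ i ((hh z hz).trans_le hi) hil
    rw [← (hcoh z (hZ z hz) β hβ hz).1]
    exact ⟨⟨hx.1, hxz⟩, hx.2.mono fun y hy hyx => ⟨hy, hyx.trans hxz⟩⟩
  refine ⟨_, isRow_chainUnion (Z := fun _ => accPoints (C β)) (R := accPoints (C β)) hM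
    (fun i hi _ z hz => ⟨hZ z hz, (hh z hz).trans_le hi⟩) (fun _ _ _ _ _ => subset_rfl)
    (fun i hi hil => ⟨subset_rfl, hlt, fun x hx => ?_,
      fun z hz x hx hxz => (hmem z hz x hx hxz i hi hil).1,
      fun z hz => (hrow z hz).club i ((hh z hz).trans_le hi) hil,
      fun z hz z' hz' hzz' => ((hrow z' hz').coherent z hzz' i ((hh z' hz').trans_le hi) hil
        (hmem z' hz' z hz hzz' i hi hil)).2,
      fun α hα hall => ?_, fun z hz => isLimitPoint_Iio (hZ z hz)⟩)
    (fun α hα hαβ => ?_) fun α hα i hi hil => ⟨α, hα, Or.inl rfl⟩⟩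
  · obtain ⟨y, hy, h1, -⟩ := hlim.2 x hx
    exact ⟨y, hy, h1.le⟩
  · obtain ⟨y, hy, h1, -⟩ := hlim.2 α hα
    exact absurd (hall y hy) h1.not_gt
  · obtain ⟨z, hz, h1, h2⟩ := hlim.2 α hαβ
    obtain ⟨i, hi, hil, hα'⟩ := (hrow z hz).exists_mem α hα h1
    exact ⟨i, (hh z hz).symm.trans_le hi, hil, z, hz, Or.inr hα'⟩

/-- Level i of the new row consists of all rungs of a ladder together with the rows of those rungs
that already cohere at level i. -/
theorem exists_isRow_of_not_isLimitPoint (hh : ∀ α, h α < l.ord)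
    (hβ : β ∈ accPoints (Set.Iio κ.ord))
    (hC : ∀ α ∈ accPoints (Set.Iio κ.ord), IsClubIn (C α) α)
    (hcoh : ∀ α ∈ accPoints (Set.Iio κ.ord), ∀ β ∈ accPoints (Set.Iio κ.ord),
        α ∈ accPoints (C β) → C β ∩ Set.Iio α = C α ∧ h α = h β)
    (hM : ∀ γ ∈ accPoints (Set.Iio κ.ord), γ < β → IsRow κ l h C M γ (M γ))
    (hlim : ¬ IsLimitPoint β (accPoints (C β))) : ∃ Q, IsRow κ l h C M β Q := by
  obtain ⟨f, hf, hfβ, hcof, hf0, hfL⟩ := exists_ladder hβ (hC β hβ) hlim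
  let L := accPoints (Set.Iio κ.ord)
  -- The rungs usable at level i form an initial segment of ω that grows with i. By `hGex`, each
  -- rung reached through limit ordinals only is usable at some level below λ.
  let G : Ordinal.{u} → Set ℕ := fun i =>
    {n | (∀ m ≤ n, f m ∈ L ∧ h (f m) ≤ i) ∧ ∀ m < n, f m ∈ accPoints (M (f (m + 1)) i)}
  have hrow : ∀ n, f n ∈ L → IsRow κ l h C M (f n) (M (f n)) := fun n hn => hM _ hn (hfβ n)
  have hGL : ∀ {i n}, n ∈ G i → f n ∈ L := fun hn => (hn.1 _ le_rfl).1
  have hGh : ∀ {i n}, n ∈ G i → h (f n) ≤ i := fun hn => (hn.1 _ le_rfl).2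
  have hGmono : ∀ {i j}, i ≤ j → j < l.ord → G i ⊆ G j := by
    intro i j hij hj n hn
    refine ⟨fun m hm => ⟨(hn.1 m hm).1, (hn.1 m hm).2.trans hij⟩, fun m hm => ?_⟩
    exact accPoints_mono ((hrow _ (hn.1 (m + 1) hm).1).mono i j (hn.1 (m + 1) hm).2 hij hj)
      (hn.2 m hm)
  have hGacc : ∀ {i}, i < l.ord → ∀ n, n ∈ G i → ∀ m < n, f m ∈ accPoints (M (f n) i) := by
    intro i hil n
    induction n with
    | zero => exact fun _ m hm => absurd hm (Nat.not_lt_zero m)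
    | succ n ih =>
      intro hn m hm
      have hn' : n ∈ G i := ⟨fun m hm => hn.1 m (hm.trans n.le_succ),
        fun m hm => hn.2 m (hm.trans n.lt_succ_self)⟩
      have hacc := hn.2 n n.lt_succ_self
      rcases (Nat.lt_succ_iff.1 hm).eq_or_lt with rfl | hlt
      · exact hacc
      · refine accPoints_mono ?_ (ih hn' m hlt)
        rw [((hrow _ (hGL hn)).coherent (f n) (hf n.lt_succ_self) i (hGh hn) hil hacc).2]
        exact Set.inter_subset_left
  have hGex : ∀ n, (∀ m ≤ n, f m ∈ L) → ∃ i < l.ord, h β ≤ i ∧ n ∈ G i := by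
    intro n
    induction n with
    | zero =>
      intro hn
      refine ⟨max (h β) (h (f 0)), max_lt (hh _) (hh _), le_max_left _ _, fun m hm => ?_,
        fun m hm => absurd hm (Nat.not_lt_zero m)⟩
      rw [Nat.le_zero.1 hm]
      exact ⟨hn 0 le_rfl, le_max_right _ _⟩
    | succ n ih =>
      intro hn
      obtain ⟨i, hil, hi, hnG⟩ := ih fun m hm => hn m (hm.trans n.le_succ)
      have hr := hrow _ (hn (n + 1) le_rfl)
      obtain ⟨j, hj, hjl, hacc⟩ := hr.exists_mem (f n) (hn n n.le_succ) (hf n.lt_succ_self)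
      have hk : max i j < l.ord := max_lt hil hjl
      have hnG' := hGmono (le_max_left i j) hk hnG
      refine ⟨max i j, hk, hi.trans (le_max_left _ _), fun m hm => ⟨hn m hm, ?_⟩, fun m hm => ?_⟩
      · rcases hm.eq_or_lt with rfl | hlt
        · exact hj.trans (le_max_right _ _)
        · exact (hnG'.1 m (Nat.lt_succ_iff.1 hlt)).2
      · rcases (Nat.lt_succ_iff.1 hm).eq_or_lt with rfl | hlt
        · exact accPoints_mono (hr.mono j _ hj (le_max_right _ _) hk) hacc
        · exact hnG'.2 m hlt
  refine ⟨_, isRow_chainUnion (Z := fun i => f '' G i) (R := Set.range f) hM ?_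
    (fun i j _ hij hj => Set.image_mono (hGmono hij hj)) (fun i hi hil => ?_)
    (fun α hα hαβ => ?_) fun α hα i hi hil => ?_⟩
  · rintro i hi hil _ ⟨n, hn, rfl⟩
    exact ⟨hGL hn, hGh hn⟩
  · refine ⟨Set.image_subset_range f _, ?_, fun x hx => ?_, ?_, ?_, ?_, fun α hα _ hαlim => ?_, ?_⟩
    · rintro _ ⟨n, rfl⟩
      exact hfβ n
    · obtain ⟨n, hn⟩ := hcof x hx
      exact ⟨f n, ⟨n, rfl⟩, hn⟩
    · rintro _ ⟨n, hn, rfl⟩ _ ⟨m, rfl⟩ hlt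
      exact (hGacc hil n hn m (hf.lt_iff_lt.1 hlt)).1
    · rintro _ ⟨n, hn, rfl⟩
      exact (hrow n (hGL hn)).club i (hGh hn) hil
    · rintro _ ⟨m, hm, rfl⟩ _ ⟨n, hn, rfl⟩ hlt
      exact ((hrow n (hGL hn)).coherent (f m) hlt i (hGh hn) hil
        (hGacc hil n hn m (hf.lt_iff_lt.1 hlt))).2
    -- The ladder is increasing and cofinal in β, so only finitely many rungs lie below α and they
    -- do not accumulate at α.
    · classical
      have hex := hcof α hα
      have hk := Nat.find_spec hex
      rcases hk0 : Nat.find hex with _ | k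
      · rw [hk0] at hk
        obtain ⟨_, ⟨m, rfl⟩, -, hm⟩ := hαlim.2 0 (pos_iff_ne_zero.2 hαlim.1)
        exact (hm.trans_le hk).not_ge (hf.monotone m.zero_le)
      · rw [hk0] at hk
        have hk' : f k < α := not_le.1 (Nat.find_min hex (hk0 ▸ k.lt_succ_self))
        obtain ⟨_, ⟨m, rfl⟩, h1, h2⟩ := hαlim.2 _ hk'
        have h3 := hf.lt_iff_lt.1 h1
        have h4 := hf.lt_iff_lt.1 (h2.trans_le hk)
        omega
    · rintro _ ⟨n, hn, rfl⟩
      exact isLimitPoint_Iio (hGL hn)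
  · obtain ⟨n, hn, hnL⟩ := hfL α hα hαβ
    obtain ⟨i, hil, hi, hnG⟩ := hGex n hnL
    rcases hn.eq_or_lt with rfl | hlt
    · exact ⟨i, hi, hil, f n, ⟨n, hnG, rfl⟩, Or.inl rfl⟩
    · have hr := hrow _ (hGL hnG)
      obtain ⟨j, hj, hjl, hacc⟩ := hr.exists_mem α hα hlt
      have hk : max i j < l.ord := max_lt hil hjl
      exact ⟨max i j, hi.trans (le_max_left _ _), hk, f n,
        ⟨n, hGmono (le_max_left i j) hk hnG, rfl⟩,
        Or.inr (accPoints_mono (hr.mono j _ hj (le_max_right _ _) hk) hacc)⟩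
  -- Rung 0 is the largest point of acc(C_β) and has the index of β, so it is usable at every level
  -- i ≥ h β.
  · obtain ⟨h0, hle⟩ := hf0 α hα
    have h0L : f 0 ∈ L := h0.2.mem_accPoints_Iio ((hfβ 0).trans hβ.1)
    obtain ⟨hC0, hh0⟩ := hcoh _ h0L β hβ h0
    refine ⟨f 0, ⟨0, ⟨fun m hm => ?_, fun m hm => absurd hm (Nat.not_lt_zero m)⟩, rfl⟩, ?_⟩
    · rw [Nat.le_zero.1 hm]
      exact ⟨h0L, hh0.trans_le hi⟩
    · refine hle.eq_or_lt.imp_right fun hlt => ?_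
      refine (hrow 0 h0L).refines α ?_ i (hh0.trans_le hi) hil
      rw [← hC0]
      exact ⟨⟨hα.1, hlt⟩, hα.2.mono fun y hy hyα => ⟨hy, hyα.trans hlt⟩⟩

end Row

/-- Dependent choice along the ordinals. -/
theorem exists_rec_of_extension {X : Type v} [Nonempty X]
    (P : (Ordinal.{u} → X) → Ordinal.{u} → X → Prop)
    (hcongr : ∀ M M' β x, (∀ γ < β, M γ = M' γ) → P M β x → P M' β x)
    (hext : ∀ M β, (∀ γ < β, P M γ (M γ)) → ∃ x, P M β x) : ∃ M, ∀ β, P M β (M β) := by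
  classical
  let x₀ : X := Classical.arbitrary X
  -- Resetting the values from β on makes the choice at β depend on earlier values only; `hcongr`
  -- undoes the truncation.
  let T : (Ordinal.{u} → X) → Ordinal.{u} → Ordinal.{u} → X := fun M β γ => if γ < β then M γ else x₀
  let pick : (Ordinal.{u} → X) → Ordinal.{u} → X := fun M β =>
    if h : ∃ x, P M β x then h.choose else x₀
  let M : Ordinal.{u} → X := WellFounded.fix (C := fun _ => X) (wellFounded_lt (α := Ordinal.{u}))
    fun β rec => pick (fun γ => if h : γ < β then rec γ h else x₀) β
  have hM : ∀ β, M β = pick (T M β) β := by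
    intro β
    have := WellFounded.fix_eq (C := fun _ => X) (wellFounded_lt (α := Ordinal.{u}))
      (fun β rec => pick (fun γ => if h : γ < β then rec γ h else x₀) β) β
    exact this
  refine ⟨M, fun β => ?_⟩
  induction β using WellFoundedLT.induction with
  | _ β ih =>
  have hTM : ∀ γ < β, M γ = T M β γ := fun γ hγ => (if_pos hγ).symm
  obtain hx : ∃ x, P (T M β) β x := hext _ β fun γ hγ => by
    rw [← hTM γ hγ]
    exact hcongr M _ γ _ (fun ζ hζ => hTM ζ (hζ.trans hγ)) (ih γ hγ)
  have hpick : P (T M β) β (pick (T M β) β) := by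
    simp only [pick, dif_pos hx]
    exact hx.choose_spec
  rw [← hM β] at hpick
  exact hcongr _ M β _ (fun γ hγ => (hTM γ hγ).symm) hpick

theorem exists_rows {κ l : Cardinal.{u}} {h : Ordinal.{u} → Ordinal.{u}}
    {C : Ordinal.{u} → Set Ordinal.{u}} (hh : ∀ α, h α < l.ord)
    (hC : ∀ α ∈ accPoints (Set.Iio κ.ord), IsClubIn (C α) α)
    (hcoh : ∀ α ∈ accPoints (Set.Iio κ.ord), ∀ β ∈ accPoints (Set.Iio κ.ord),
        α ∈ accPoints (C β) → C β ∩ Set.Iio α = C α ∧ h α = h β) :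
    ∃ M : Ordinal.{u} → Ordinal.{u} → Set Ordinal.{u},
      ∀ β ∈ accPoints (Set.Iio κ.ord), IsRow κ l h C M β (M β) := by
  refine exists_rec_of_extension
    (fun M β Q => β ∈ accPoints (Set.Iio κ.ord) → IsRow κ l h C M β Q) ?_ ?_
  · intro M M' β Q hMM' hQ hβ
    have := hQ hβ
    exact ⟨this.club, this.mono, fun α hα => hMM' α hα ▸ this.coherent α hα, this.exists_mem,
      this.refines⟩
  · intro M β hM
    by_cases hβ : β ∈ accPoints (Set.Iio κ.ord)
    · by_cases hlim : IsLimitPoint β (accPoints (C β))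
      · obtain ⟨Q, hQ⟩ := exists_isRow_of_isLimitPoint hβ hC hcoh (fun γ h1 h2 => hM γ h2 h1) hlim
        exact ⟨Q, fun _ => hQ⟩
      · obtain ⟨Q, hQ⟩ := exists_isRow_of_not_isLimitPoint hh hβ hC hcoh
          (fun γ h1 h2 => hM γ h2 h1) hlim
        exact ⟨Q, fun _ => hQ⟩
    · exact ⟨fun _ => ∅, fun h => absurd h hβ⟩

/-! ### The matrix has no thread. -/

theorem isIndexedSquareSeq_of_stationaryIn {κ l : Cardinal.{u}} (hκ : κ.IsRegular) (hunc : ℵ₀ < κ)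
    (hlκ : l < κ) {h : Ordinal.{u} → Ordinal.{u}} {C : Ordinal.{u} → Set Ordinal.{u}}
    {M : Ordinal.{u} → Ordinal.{u} → Set Ordinal.{u}} (hh : ∀ α, h α < l.ord)
    (hM : ∀ β ∈ accPoints (Set.Iio κ.ord), IsRow κ l h C M β (M β))
    (hst : ∀ i < l.ord, StationaryIn κ {α | i < h α}) : IsIndexedSquareSeq κ l h M where
  ind_lt α _ := hh α
  club α hα := (hM α hα).club
  mono α hα i j hi hij hj := (hM α hα).mono i j hi hij.le hj
  coherent α _ β hβ i hi hil hαβ :=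
    (hM β hβ).coherent α (((hM β hβ).club i hi hil).subset hαβ.1) i hi hil hαβ
  exists_mem α hα β hβ hαβ := (hM β hβ).exists_mem α hα hαβ
  no_thread := by
    rintro ⟨D, hD, hthread⟩
    have hI : ∀ α, ∃ i, α ∈ accPoints D → h α ≤ i ∧ i < l.ord ∧ M α i = D ∩ Set.Iio α := by
      intro α
      by_cases hα : α ∈ accPoints D
      · obtain ⟨i, hi⟩ := hthread α hα
        exact ⟨i, fun _ => hi⟩
      · exact ⟨0, fun h => absurd h hα⟩
    choose I hI using hI
    have hlκ' : l.ord < κ.ord := Cardinal.ord_lt_ord.2 hlκ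
    have hDlim : IsLimitPoint κ.ord D := hD.isLimitPoint ⟨hκ.ord_pos.ne', fun β hβ =>
      ⟨β + 1, add_one_lt_ord hκ hβ, lt_add_one β, add_one_lt_ord hκ hβ⟩⟩
    have hacc : IsClubIn (accPoints D) κ.ord := by
      refine ⟨fun α hα => hD.subset hα.1, fun β hβ hlim => ?_, fun β hβ => ?_⟩
      · have h' : IsLimitPoint β D := hlim.mono fun _ h _ => h.1
        exact ⟨hD.closed β hβ h', h'⟩
      · by_contra! hcon
        have hN : ∀ x, ∃ y, x < κ.ord → y ∈ D ∧ x < y := fun x => by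
          by_cases hx : x < κ.ord
          · obtain ⟨y, hy, h1, -⟩ := hDlim.2 x hx
            exact ⟨y, fun _ => ⟨hy, h1⟩⟩
          · exact ⟨0, fun h => absurd h hx⟩
        choose N hN using hN
        obtain ⟨δ, ⟨hδ, hδ0, hcl⟩, hβδ⟩ := (isClubIn_closed_under hκ hunc N
          fun x hx => hD.subset (hN x hx).1).unbounded β hβ
        have hlim : IsLimitPoint δ D := ⟨hδ0, fun x hx =>
          ⟨N x, (hN x (hx.trans hδ)).1, (hN x (hx.trans hδ)).2, hcl x hx⟩⟩
        exact (hcon δ ⟨hD.closed δ hδ hlim, hlim⟩).not_ge hβδ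
    have hDκ : ∀ α ∈ accPoints D, α ∈ accPoints (Set.Iio κ.ord) := fun α hα =>
      hα.2.mem_accPoints_Iio (hD.subset hα.1)
    -- Colour 0 merely supplies a stationary set. Above λ the level I is regressive, hence
    -- constantly some i on a stationary set; a point of acc(D) of index above i then contradicts
    -- coherence with a later row.
    have hS := (isClubIn_Ioo hκ hlκ').stationaryIn_inter hκ hunc
      (hacc.stationaryIn_inter hκ hunc (hst 0 ((zero_le).trans_lt (hh 0))))
    obtain ⟨i, -, hU⟩ := hS.exists_fiber hκ hunc I
      fun α hα _ => (hI α hα.1.2).2.1.trans hα.2.1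
    obtain ⟨α₀, hα₀, -, -⟩ := hU.exists_gt hκ hκ.ord_pos
    have hil : i < l.ord := hα₀.2 ▸ (hI α₀ hα₀.1.1.2).2.1
    obtain ⟨α, hα, hαD⟩ := hst i hil _ hacc
    obtain ⟨β, hβ, hαβ, hβκ⟩ := hU.exists_gt hκ (hD.subset hαD.1)
    obtain ⟨h1, h2, h3⟩ := hI β hβ.1.1.2
    rw [hβ.2] at h1 h2 h3
    have : α ∈ accPoints (M β i) := by
      rw [h3]
      exact ⟨⟨hαD.1, hαβ⟩, hαD.2.mono fun y hy hyα => ⟨hy, hyα.trans hαβ⟩⟩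
    exact hα.not_ge (((hM β (hDκ β hβ.1.1.2)).coherent α hαβ i h1 h2 this).1)

theorem mem_accPoints_Iio_of_le_cof {o α : Ordinal.{u}} (hα : α < o) (hcof : ℵ₀ ≤ α.cof) :
    α ∈ accPoints (Set.Iio o) := by
  have h := one_lt_cof_iff.1 (aleph0_le_cof_iff.1 hcof)
  exact ⟨hα, h.ne_bot, fun β hβ =>
    ⟨β + 1, (h.add_one_lt hβ).trans hα, lt_add_one β, h.add_one_lt hβ⟩⟩

/-- Iterating the next-point function of a club λ times gives a strictly increasing sequence whose
supremum is in the club and has cofinality λ. -/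
theorem stationaryIn_cof_eq {κ l : Cardinal.{u}} (hκ : κ.IsRegular) (hl : l.IsRegular)
    (hlκ : l < κ) : StationaryIn κ {α | α < κ.ord ∧ α.cof = l} := by
  intro D hD
  have hN : ∀ x, ∃ y, x < y ∧ (x < κ.ord → y ∈ D) := fun x => by
    by_cases hx : x < κ.ord
    · obtain ⟨y, hy, h1⟩ := hD.unbounded _ (add_one_lt_ord hκ hx)
      exact ⟨y, (lt_add_one x).trans_le h1, fun _ => hy⟩
    · exact ⟨x + 1, lt_add_one x, fun h => absurd h hx⟩
  choose g hg hgD using hN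
  have hgκ : ∀ α < κ.ord, g α < κ.ord := fun α hα => hD.subset (hgD α hα)
  have hd : ∀ {ξ}, ξ < κ.ord → iterateSup g ξ < κ.ord := fun h => iterateSup_lt_ord hκ hgκ h
  have hlκ' : l.ord < κ.ord := Cardinal.ord_lt_ord.2 hlκ
  have hlim := isSuccLimit_ord hl.aleph0_le
  have hδ : iterateSup g l.ord = ⨆ ζ : Set.Iio l.ord, g (iterateSup g ζ.1) := by
    conv_lhs => rw [iterateSup]
  refine ⟨iterateSup g l.ord, ⟨hd hlκ', ?_⟩, hD.closed _ (hd hlκ') ⟨?_, fun b hb => ?_⟩⟩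
  · rw [hδ, cof_iSup_Iio _ hlim.isSuccPrelimit, hl.cof_ord]
    intro ζ ξ h
    exact (le_iterateSup g h).trans_lt (hg _)
  · exact (zero_le.trans_lt ((hg (iterateSup g 0)).trans_le (le_iterateSup g hl.ord_pos))).ne'
  · rw [hδ] at hb
    obtain ⟨⟨ζ, hζ⟩, h⟩ := exists_lt_of_lt_ciSup' hb
    have hζ' : ζ + 1 < l.ord := hlim.add_one_lt hζ
    exact ⟨g (iterateSup g ζ), hgD _ (hd (hζ.trans hlκ')), h,
      ((le_iterateSup g (lt_add_one ζ)).trans_lt (hg _)).trans_le (le_iterateSup g hζ')⟩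

/-! ### Conditions of the lottery sum and the large antichain. -/

section Lottery

variable {κ l : Cardinal.{u}} {ind : Ordinal.{u} → Ordinal.{u}}
  {C : Ordinal.{u} → Ordinal.{u} → Set Ordinal.{u}}

open Classical in
/-- The partial function on ordinals given by a condition of the lottery sum. -/
noncomputable def SquareLottery.val (x : SquareLottery κ l ind C) (β : Ordinal.{u}) : Option ℕ :=
  if h : β ∈ accPoints (Set.Iio κ.ord) ∧ ind β ≤ x.index.1 then x.cond.toFun ⟨β, h⟩ else none

theorem SquareLottery.mem_of_val_ne_none {x : SquareLottery κ l ind C} {β : Ordinal.{u}}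
    (h : x.val β ≠ none) : β ∈ accPoints (Set.Iio κ.ord) ∧ ind β ≤ x.index.1 := by
  by_contra hβ
  exact h (dif_neg hβ)

theorem SquareLottery.val_eq {i : Set.Iio l.ord} {p : SpecializingPoset (treeLT κ ind C i.1)}
    (t : TreeNode κ ind i.1) : SquareLottery.val (C := C) ⟨i, p⟩ t.1 = p.toFun t :=
  dif_pos t.2

theorem SquareLottery.finite_val (x : SquareLottery κ l ind C) : {β | x.val β ≠ none}.Finite := by
  refine (x.cond.finite_dom.image Subtype.val).subset fun β hβ => ?_
  have h := mem_of_val_ne_none hβ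
  exact ⟨⟨β, h⟩, fun h' => hβ (by rw [val, dif_pos h, h']), rfl⟩

theorem SquareLottery.val_ne_of_mem (hI : IsIndexedSquareSeq κ l ind C)
    {x : SquareLottery κ l ind C} {β γ : Ordinal.{u}} (hβ : x.val β ≠ none)
    (h : β ∈ accPoints (C γ x.index.1)) : x.val β ≠ x.val γ := by
  intro heq
  have hγ : x.val γ ≠ none := heq ▸ hβ
  obtain ⟨i, p⟩ := x
  have h1 := mem_of_val_ne_none hβ
  have h2 := mem_of_val_ne_none hγ
  let t : TreeNode κ ind i.1 := ⟨β, h1⟩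
  let s : TreeNode κ ind i.1 := ⟨γ, h2⟩
  have hlt : β < γ := (hI.club γ h2.1 i.1 h2.2 i.2).subset h.1
  have ht : p.toFun t = SquareLottery.val (C := C) ⟨i, p⟩ β := (val_eq t).symm
  have hs : p.toFun s = SquareLottery.val (C := C) ⟨i, p⟩ γ := (val_eq s).symm
  have hts : treeLT κ ind C i.1 t s := h
  have hchain : IsChain (treeLT κ ind C i.1) {t, s} :=
    IsChain.pair hts
  have := p.injOn_chain _ hchain (x₁ := t) (x₂ := s) ⟨by simp, by rw [Set.mem_ofPred_eq, ht]; exact hβ⟩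
    ⟨by simp, by rw [Set.mem_ofPred_eq, hs]; exact hγ⟩ (by rw [ht, hs, heq])
  exact hlt.ne (congrArg Subtype.val this)

/-- The union of the two functions is a common extension; only pairs with one node from each domain
can violate injectivity on chains. -/
theorem SquareLottery.compatible_of_val {x y : SquareLottery κ l ind C} (hxy : x.index = y.index)
    (hagree : ∀ β, x.val β ≠ none → y.val β ≠ none → x.val β = y.val β)
    (hinj : ∀ β γ, x.val β ≠ none → x.val β = y.val γ →
      β ∉ accPoints (C γ x.index.1) ∧ γ ∉ accPoints (C β x.index.1)) : Compatible x y := by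
  obtain ⟨i, p⟩ := x
  obtain ⟨j, q⟩ := y
  obtain rfl : i = j := hxy
  have hagree' : ∀ t m n, p.toFun t = some m → q.toFun t = some n → m = n := by
    intro t m n hp hq
    have := hagree t.1 (by simp [val_eq, hp]) (by simp [val_eq, hq])
    rw [val_eq, val_eq, hp, hq] at this
    exact Option.some.inj this
  have hinj' : ∀ t s n, p.toFun t = some n → q.toFun s = some n →
      ¬ treeLT κ ind C i.1 t s ∧ ¬ treeLT κ ind C i.1 s t := by
    intro t s n hp hq
    exact hinj t.1 s.1 (by simp [val_eq, hp]) (by rw [val_eq, val_eq, hp, hq])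
  have hcases : ∀ t n, (p.toFun t <|> q.toFun t) = some n →
      p.toFun t = some n ∨ q.toFun t = some n := by
    intro t n h
    rcases hp : p.toFun t with _ | m
    · rw [hp] at h
      exact Or.inr h
    · rw [hp] at h
      exact Or.inl h
  refine ⟨⟨i, ⟨fun t => p.toFun t <|> q.toFun t, ?_, fun c hc t ht s hs hts => ?_⟩⟩, ?_, ?_⟩
  · refine (p.finite_dom.union q.finite_dom).subset fun t ht => ?_
    obtain ⟨n, hn⟩ := Option.ne_none_iff_exists'.1 ht
    rcases hcases t n hn with h | h
    · exact Or.inl (by simp [h])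
    · exact Or.inr (by simp [h])
  · obtain ⟨n, hn⟩ := Option.ne_none_iff_exists'.1 ht.2
    by_contra hne
    have hcmp := hc ht.1 hs.1 hne
    rcases hcases t n hn with h | h <;> rcases hcases s n (hts.symm.trans hn) with h' | h'
    · exact hne (p.injOn_chain c hc ⟨ht.1, by simp [h]⟩ ⟨hs.1, by simp [h']⟩ (h.trans h'.symm))
    · have := hinj' t s n h h'
      tauto
    · have := hinj' s t n h' h
      tauto
    · exact hne (q.injOn_chain c hc ⟨ht.1, by simp [h]⟩ ⟨hs.1, by simp [h']⟩ (h.trans h'.symm))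
  · refine Or.inl ⟨i, _, p, rfl, rfl, fun t n h => ?_⟩
    change (p.toFun t <|> q.toFun t) = some n
    rw [h]
    rfl
  · refine Or.inl ⟨i, _, q, rfl, rfl, fun t n h => ?_⟩
    change (p.toFun t <|> q.toFun t) = some n
    rcases hp : p.toFun t with _ | m
    · exact h
    · rw [hagree' t m n hp h]
      rfl

open Classical in
/-- The condition with domain `{t}` and value `0`. -/
noncomputable def SpecializingPoset.single {T : Type*} {r : T → T → Prop} (t : T) :
    SpecializingPoset r where
  toFun s := if s = t then some 0 else none
  finite_dom := (Set.finite_singleton t).subset fun s hs => by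
    by_contra h
    exact hs (if_neg h)
  injOn_chain c _ s hs s' hs' _ := by
    have h : ∀ {s}, (if s = t then some 0 else none : Option ℕ) ≠ none → s = t := fun hs => by
      by_contra h
      exact hs (if_neg h)
    exact (h hs.2).trans (h hs'.2).symm

theorem SpecializingPoset.single_apply {T : Type*} {r : T → T → Prop} (t : T) :
    (single (r := r) t).toFun t = some 0 := if_pos rfl

theorem LotterySum.exists_of_le {ι : Type*} {Q : ι → Type*} [∀ i, PartialOrder (Q i)]
    [∀ i, OrderTop (Q i)] {x : LotterySum Q} {i : ι} {p : Q i} (hp : p ≠ ⊤)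
    (h : x ≤ (⟨i, p⟩ : LotterySum Q)) : ∃ p', x = ⟨i, p'⟩ ∧ p' ≤ p := by
  rcases h with ⟨j, p₁, q, rfl, h, hle⟩ | h
  · cases h
    exact ⟨p₁, rfl, hle⟩
  · exact absurd h hp

theorem SpecializingPoset.single_ne_top {T : Type*} {r : T → T → Prop} (t : T) :
    single (r := r) t ≠ ⊤ := fun h => by
  have h1 := single_apply (r := r) t
  rw [h] at h1
  cases h1

theorem SquareLottery.not_le_single (hI : IsIndexedSquareSeq κ l ind C) {i : Set.Iio l.ord}
    {t s : TreeNode κ ind i.1} (hts : treeLT κ ind C i.1 t s) {x : SquareLottery κ l ind C}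
    (ht : x ≤ (⟨i, .single t⟩ : SquareLottery κ l ind C)) :
    ¬ x ≤ (⟨i, .single s⟩ : SquareLottery κ l ind C) := by
  intro hs
  obtain ⟨p, rfl, hp⟩ := LotterySum.exists_of_le
    (Q := fun i : Set.Iio l.ord => SpecializingPoset (treeLT κ ind C i.1))
    (SpecializingPoset.single_ne_top t) ht
  obtain ⟨q, hpq, hq⟩ := LotterySum.exists_of_le
    (Q := fun i : Set.Iio l.ord => SpecializingPoset (treeLT κ ind C i.1))
    (SpecializingPoset.single_ne_top s) hs
  cases hpq
  have h1 := hp t 0 (SpecializingPoset.single_apply t)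
  have h2 := hq s 0 (SpecializingPoset.single_apply s)
  refine SquareLottery.val_ne_of_mem hI (x := ⟨i, p⟩) (β := t.1) (γ := s.1) ?_ hts ?_
  · rw [val_eq, h1]
    simp
  · rw [val_eq, val_eq, h1, h2]

variable {P : Type u} [PartialOrder P]

/-- A representative in the lottery sum of a condition of an isomorphic partial order. -/
noncomputable def lotteryRep (e : P ≃o Antisymmetrization (SquareLottery κ l ind C) (· ≤ ·))
    (p : P) : SquareLottery κ l ind C :=
  ofAntisymmetrization (· ≤ ·) (e p)

/-- The condition of an isomorphic partial order represented by an element of the lottery sum. -/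
def lotteryClass (e : P ≃o Antisymmetrization (SquareLottery κ l ind C) (· ≤ ·))
    (x : SquareLottery κ l ind C) : P :=
  e.symm (toAntisymmetrization (· ≤ ·) x)

theorem le_lotteryClass (e : P ≃o Antisymmetrization (SquareLottery κ l ind C) (· ≤ ·))
    {p : P} {x : SquareLottery κ l ind C} :
    p ≤ lotteryClass e x ↔ lotteryRep e p ≤ x := by
  rw [lotteryClass, OrderIso.le_symm_apply, lotteryRep,
    ← toAntisymmetrization_ofAntisymmetrization (· ≤ ·) (e p),
    toAntisymmetrization_le_toAntisymmetrization_iff, toAntisymmetrization_ofAntisymmetrization]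

theorem lotteryClass_le (e : P ≃o Antisymmetrization (SquareLottery κ l ind C) (· ≤ ·))
    {p : P} {x : SquareLottery κ l ind C} :
    lotteryClass e x ≤ p ↔ x ≤ lotteryRep e p := by
  rw [lotteryClass, OrderIso.symm_apply_le, lotteryRep,
    ← toAntisymmetrization_ofAntisymmetrization (· ≤ ·) (e p),
    toAntisymmetrization_le_toAntisymmetrization_iff, toAntisymmetrization_ofAntisymmetrization]

theorem fullPower_compatible (e : P ≃o Antisymmetrization (SquareLottery κ l ind C) (· ≤ ·))
    {μ : Cardinal.{u}} {p q : FullPower P μ}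
    (h : ∀ k, Compatible (lotteryRep e (p k)) (lotteryRep e (q k))) : Compatible p q := by
  choose r hr using h
  exact ⟨fun k => lotteryClass e (r k), fun k => (lotteryClass_le e).2 (hr k).1,
    fun k => (lotteryClass_le e).2 (hr k).2⟩

theorem not_chainCondition (e : P ≃o Antisymmetrization (SquareLottery κ l ind C) (· ≤ ·))
    (hκ : κ.IsRegular) (hunc : ℵ₀ < κ) (hl : l.IsRegular) (hlκ : l < κ)
    (hI : IsIndexedSquareSeq κ l ind C) : ¬ ChainCondition κ (FullPower P l) := by
  classical
  intro hcc
  let S : Set Ordinal.{u} := {α | α < κ.ord ∧ α.cof = l}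
  have hS : StationaryIn κ S := stationaryIn_cof_eq hκ hl hlκ
  have hSlim : S ⊆ accPoints (Set.Iio κ.ord) := fun α hα =>
    mem_accPoints_Iio_of_le_cof hα.1 (hα.2 ▸ hl.aleph0_le)
  let q : Ordinal.{u} → FullPower P l := fun α k => lotteryClass e
    (if h : α ∈ accPoints (Set.Iio κ.ord) ∧ ind α ≤ (ToType.mk.symm k).1 then
      ⟨ToType.mk.symm k, .single ⟨α, h⟩⟩ else ⟨ToType.mk.symm k, ⊤⟩)
  have hinc : ∀ α ∈ S, ∀ β ∈ S, α < β → ¬ Compatible (q α) (q β) := by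
    rintro α hα β hβ hlt ⟨r, hr1, hr2⟩
    obtain ⟨i, hi, hil, hacc⟩ := hI.exists_mem α (hSlim hα) β (hSlim hβ) hlt
    have hi' := (hI.coherent α (hSlim hα) β (hSlim hβ) i hi hil hacc).1
    let k : l.ord.ToType := ToType.mk ⟨i, hil⟩
    have hk : ToType.mk.symm k = ⟨i, hil⟩ := OrderIso.symm_apply_apply _ _
    have h1 := (le_lotteryClass e).1 (hr1 k)
    have h2 := (le_lotteryClass e).1 (hr2 k)
    rw [dif_pos ⟨hSlim hα, by rw [hk]; exact hi'⟩] at h1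
    rw [dif_pos ⟨hSlim hβ, by rw [hk]; exact hi⟩] at h2
    refine SquareLottery.not_le_single hI ?_ h1 h2
    change α ∈ accPoints (C β (ToType.mk.symm k).1)
    rw [hk]
    exact hacc
  have hsymm : ∀ {a b : FullPower P l}, Compatible a b → Compatible b a :=
    fun ⟨r, h1, h2⟩ => ⟨r, h2, h1⟩
  have hA : #(q '' S) < κ := by
    refine hcc _ ?_
    rintro _ ⟨α, hα, rfl⟩ _ ⟨β, hβ, rfl⟩ hne hcomp
    rcases lt_trichotomy α β with h | rfl | h
    · exact hinc α hα β hβ h hcomp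
    · exact hne rfl
    · exact hinc β hβ α hα h (hsymm hcomp)
  -- If the antichain had fewer than κ elements, two different α would give the same condition,
  -- which is compatible with itself.
  obtain ⟨x, -, hx⟩ := hS.exists_fiber_of_mapsTo hκ hunc (Y := q '' S)
    (by simpa using hA) q fun α hα _ => ⟨α, hα, rfl⟩
  obtain ⟨α, hα, -, hακ⟩ := hx.exists_gt hκ hκ.ord_pos
  obtain ⟨β, hβ, hαβ, -⟩ := hx.exists_gt hκ hακ
  refine hinc α hα.1 β hβ.1 hαβ ?_
  rw [hα.2, hβ.2]
  exact ⟨x, le_rfl, le_rfl⟩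

end Lottery

/-! ### The Knaster property of small powers. -/

theorem exists_uniform_bound {ι : Type v} {α : Ordinal.{u}} {Q : ι → Ordinal.{u} → Prop}
    (hι : Cardinal.lift.{u} #ι < Cardinal.lift.{v} α.cof)
    (hmono : ∀ i b b', b ≤ b' → Q i b → Q i b') (h : ∀ i, ∃ b < α, Q i b) :
    ∃ b < α, ∀ i, Q i b := by
  choose g hg hQ using h
  obtain ⟨b, hb, h⟩ := exists_bound_of_lt_cof hι g hg
  exact ⟨b, hb, fun i => hmono i _ _ (h i).le (hQ i)⟩

theorem exists_uniform_bound_of_finite {α : Ordinal.{u}} {K : Type u}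
    {Q : K → Ordinal.{u} → Ordinal.{u} → Prop} (hK : #K < α.cof) (hα : ℵ₀ ≤ α.cof)
    {s : K → Set Ordinal.{u}} (hs : ∀ k, (s k).Finite)
    (hmono : ∀ k, ∀ β ∈ s k, ∀ b b', b ≤ b' → Q k β b → Q k β b')
    (h : ∀ k, ∀ β ∈ s k, ∃ b < α, Q k β b) : ∃ b < α, ∀ k, ∀ β ∈ s k, Q k β b := by
  refine exists_uniform_bound (Q := fun k b => ∀ β ∈ s k, Q k β b) (by simpa using hK)
    (fun k b b' hb hQ β hβ => hmono k β hβ b b' hb (hQ β hβ)) fun k => ?_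
  have hfin : #(s k) < ℵ₀ := (hs k).lt_aleph0
  obtain ⟨b, hb, hQ⟩ := exists_uniform_bound (ι := s k) (α := α) (Q := fun β b => Q k β.1 b)
    (lt_of_lt_of_le (by simpa using hfin) (Cardinal.aleph0_le_lift.2 hα))
    (fun β => hmono k β.1 β.2) fun β => h k β.1 β.2
  exact ⟨b, hb, fun β hβ => hQ ⟨β, hβ⟩⟩

theorem exists_enumeration {κ : Cardinal.{u}} (hκ : κ ≠ 0) {X : Type u} {A : Set X} (hA : #A = κ) :
    ∃ en : Ordinal.{u} → X, (∀ α, en α ∈ A) ∧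
      ∀ α < κ.ord, ∀ β < κ.ord, en α = en β → α = β := by
  classical
  obtain ⟨E⟩ : Nonempty (κ.ord.ToType ≃ A) := by
    rw [← Cardinal.eq, mk_toType, card_ord, hA]
  have : Nonempty A := by
    rw [← Cardinal.mk_ne_zero_iff, hA]
    exact hκ
  obtain ⟨a⟩ := this
  refine ⟨fun α => if h : α < κ.ord then (E (ToType.mk ⟨α, h⟩)).1 else a.1, fun α => ?_,
    fun α hα β hβ h => ?_⟩
  · dsimp only
    split_ifs
    · exact Subtype.prop _
    · exact a.2
  · dsimp only at h
    rw [dif_pos hα, dif_pos hβ] at h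
    exact congrArg Subtype.val (ToType.mk.injective (E.injective (Subtype.ext h)))

theorem Compatible.symm {P : Type*} [LE P] {p q : P} (h : Compatible p q) : Compatible q p :=
  let ⟨r, h1, h2⟩ := h
  ⟨r, h2, h1⟩

theorem mk_finset_arrow_lt {κ μ : Cardinal.{u}} (hunc : ℵ₀ < κ) (hμ : ∀ ν < κ, ν ^ μ < κ)
    {K : Type u} (hK : #K = μ) {η : Ordinal.{u}} (hη : η < κ.ord) (hωη : ω ≤ η) :
    #(K → Finset (η.ToType × ℕ)) < κ := by
  have hη' : ℵ₀ ≤ #η.ToType := by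
    rw [mk_toType, aleph0_le_card]
    exact hωη
  have : Infinite η.ToType := Cardinal.infinite_iff.2 hη'
  rw [← Cardinal.power_def, hK, Cardinal.mk_finset_of_infinite]
  refine hμ _ ?_
  rw [Cardinal.mk_prod, Cardinal.lift_uzero, Cardinal.mk_nat, Cardinal.lift_aleph0]
  refine Cardinal.mul_lt_of_lt hunc.le ?_ hunc
  rw [mk_toType]
  exact Cardinal.lt_ord.1 hη

section Knaster

variable {κ l : Cardinal.{u}} {ind : Ordinal.{u} → Ordinal.{u}}
  {C : Ordinal.{u} → Ordinal.{u} → Set Ordinal.{u}} {P : Type u} [PartialOrder P]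

/-- For β ≥ α, unboundedness of acc(C β i) in α would make α equal to β or one of its predecessors
in the i-th tree, so that ind α ≤ i. -/
theorem exists_bound_below (hI : IsIndexedSquareSeq κ l ind C) {α : Ordinal.{u}}
    {x : SquareLottery κ l ind C} (hα : x.index.1 < ind α) (hαlim : α ∈ accPoints (Set.Iio κ.ord))
    {β : Ordinal.{u}} (hβ : x.val β ≠ none) :
    ∃ b < α, (β < α → β < b) ∧ (α ≤ β → ∀ ξ ∈ accPoints (C β x.index.1), ξ < α → ξ < b) := by
  obtain ⟨hβlim, hβi⟩ := SquareLottery.mem_of_val_ne_none hβ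
  rcases lt_or_ge β α with hlt | hle
  · exact ⟨β + 1, hαlim.2.add_one_lt hlt, fun _ => lt_add_one β, fun h => absurd hlt h.not_gt⟩
  · have hclub := hI.club β hβlim _ hβi x.index.2
    have hnl : ¬ IsLimitPoint α (accPoints (C β x.index.1)) := fun h => by
      have h' : IsLimitPoint α (C β x.index.1) := h.mono fun _ h _ => h.1
      rcases hle.eq_or_lt with rfl | hlt
      · exact hα.not_ge hβi
      · exact hα.not_ge (hI.coherent α hαlim β hβlim _ hβi x.index.2
          ⟨hclub.closed α hlt h', h'⟩).1
    simp only [IsLimitPoint, hαlim.2.1, ne_eq, not_false_eq_true, true_and, not_forall, not_exists,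
      not_and, not_lt] at hnl
    obtain ⟨b, hb, h⟩ := hnl
    refine ⟨b + 1, hαlim.2.add_one_lt hb, fun h' => absurd h' hle.not_gt, fun _ ξ hξ hξα => ?_⟩
    by_contra hbξ
    exact (h ξ hξ ((lt_add_one b).trans_le (not_lt.1 hbξ))).not_gt hξα

theorem isKnaster_fullPower (e : P ≃o Antisymmetrization (SquareLottery κ l ind C) (· ≤ ·))
    (hκ : κ.IsRegular) (hunc : ℵ₀ < κ) (hl : l.IsRegular) (hlκ : l < κ)
    (hI : IsIndexedSquareSeq κ l ind C)
    (hst : ∀ i < l.ord, StationaryIn κ {α | (α < κ.ord ∧ α.cof = l) ∧ i < ind α})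
    {μ : Cardinal.{u}} (hμl : μ < l) (hμ : ∀ ν < κ, ν ^ μ < κ) :
    IsKnaster κ (FullPower P μ) := by
  classical
  intro A hA
  obtain ⟨en, henA, hinj⟩ := exists_enumeration hκ.ne_zero hA
  let K := μ.ord.ToType
  have hK : #K = μ := by rw [mk_toType, card_ord]
  let x : Ordinal.{u} → K → SquareLottery κ l ind C := fun α k => lotteryRep e (en α k)
  -- There are λ^μ < κ possible sequences of indices, so κ many conditions share one, and its
  -- entries are bounded by some i < λ.
  obtain ⟨Φ, hT⟩ := (stationaryIn_cof_eq hκ hl hlκ).exists_fiber_of_small hκ hunc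
    (X := K → l.ord.ToType) (by
      rw [Cardinal.lift_lt, ← Cardinal.power_def, hK, mk_toType, card_ord]
      exact hμ l hlκ) fun α k => ToType.mk (x α k).index
  let idx : K → Set.Iio l.ord := fun k => ToType.mk.symm (Φ k)
  obtain ⟨i, hil, hidx⟩ := exists_bound_of_lt_cof (ι := K) (a := l.ord)
    (by rw [Cardinal.lift_lt, hK, hl.cof_ord]; exact hμl) (fun k => (idx k).1) fun k => (idx k).2
  -- Reindexing by τ attaches a condition with these indices to every α < κ, in particular to the α
  -- with ind α > i.
  have hτ : ∀ α, ∃ τ, α < κ.ord → α < τ ∧ τ < κ.ord ∧ ∀ k, (x τ k).index = idx k := fun α => by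
    by_cases hα : α < κ.ord
    · obtain ⟨τ, hτ, h1, h2⟩ := hT.exists_gt hκ hα
      refine ⟨τ, fun _ => ⟨h1, h2, fun k => ?_⟩⟩
      rw [← OrderIso.symm_apply_apply ToType.mk (x τ k).index]
      exact congrArg ToType.mk.symm (congrFun hτ.2 k)
    · exact ⟨0, fun h => absurd h hα⟩
  choose τ hτ using hτ
  let y : Ordinal.{u} → K → SquareLottery κ l ind C := fun α => x (τ α)
  have hyidx : ∀ {α}, α < κ.ord → ∀ k, (y α k).index = idx k := fun hα => (hτ _ hα).2.2
  let W : Set Ordinal.{u} := {α | (α < κ.ord ∧ α.cof = l) ∧ i < ind α}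
  have hη : ∀ α, ∃ η, α ∈ W → η < α ∧ ∀ k, ∀ β ∈ {β | (y α k).val β ≠ none},
      (β < α → β < η) ∧ (α ≤ β → ∀ ξ ∈ accPoints (C β (idx k).1), ξ < α → ξ < η) := by
    intro α
    by_cases hα : α ∈ W
    · have hcof : ℵ₀ ≤ α.cof := hα.1.2 ▸ hl.aleph0_le
      obtain ⟨η, hη⟩ := exists_uniform_bound_of_finite (K := K) (α := α)
        (Q := fun k β η => (β < α → β < η) ∧
          (α ≤ β → ∀ ξ ∈ accPoints (C β (idx k).1), ξ < α → ξ < η))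
        (by rw [hK, hα.1.2]; exact hμl) hcof (fun k => (y α k).finite_val)
        (fun k β _ b b' hb h => ⟨fun h' => (h.1 h').trans_le hb,
          fun h' ξ hξ hξα => (h.2 h' ξ hξ hξα).trans_le hb⟩)
        (fun k β hβ => by
          have hk := hyidx hα.1.1 k
          rw [← hk]
          exact exists_bound_below hI (by rw [hk]; exact (hidx k).trans hα.2)
            (mem_accPoints_Iio_of_le_cof hα.1.1 hcof) hβ)
      exact ⟨η, fun _ => hη⟩
    · exact ⟨0, fun h => absurd h hα⟩
  choose η hη using hη
  obtain ⟨η₀, hη₀κ, hW₁⟩ := (hst i hil).exists_fiber hκ hunc η fun α hα _ => (hη α hα).1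
  -- The maximum with ω makes the set of possible values infinite, so that it has as many finite
  -- subsets as elements.
  let η₁ := max η₀ ω
  have hω : ω < κ.ord := by
    rw [← ord_aleph0]
    exact Cardinal.ord_lt_ord.2 hunc
  have hη₁ : η₁ < κ.ord := max_lt hη₀κ hω
  have hfin : ∀ α k, {t : η₁.ToType × ℕ | (y α k).val (ToType.mk.symm t.1).1 = some t.2}.Finite := by
    intro α k
    refine Set.Finite.of_injOn (f := fun t => (ToType.mk.symm t.1).1)
      (t := {β | (y α k).val β ≠ none}) (fun t ht => ?_) (fun t ht s hs hts => ?_)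
      (y α k).finite_val
    · have ht' : (y α k).val (ToType.mk.symm t.1).1 = some t.2 := ht
      rw [Set.mem_ofPred_eq, ht']
      simp
    · have ht' : (y α k).val (ToType.mk.symm t.1).1 = some t.2 := ht
      have hs' : (y α k).val (ToType.mk.symm s.1).1 = some s.2 := hs
      dsimp only at hts
      rw [hts, hs'] at ht'
      exact Prod.ext (ToType.mk.symm.injective (Subtype.ext hts)) (Option.some.inj ht').symm
  obtain ⟨root, hW₂⟩ := hW₁.exists_fiber_of_small hκ hunc
    (X := K → Finset (η₁.ToType × ℕ))
    (by rw [Cardinal.lift_lt]; exact mk_finset_arrow_lt hunc hμ hK hη₁ (le_max_right _ _))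
    fun α k => (hfin α k).toFinset
  have hroot : ∀ α ∈ {α ∈ {α ∈ W | η α = η₀} | (fun k => (hfin α k).toFinset) = root},
      ∀ α' ∈ {α ∈ {α ∈ W | η α = η₀} | (fun k => (hfin α k).toFinset) = root},
      ∀ k, ∀ β < η₀, (y α k).val β = (y α' k).val β := by
    intro α hα α' hα' k β hβ
    have h := congrFun (hα.2.trans hα'.2.symm) k
    refine Option.ext fun n => ?_
    have := Finset.ext_iff.1 h (ToType.mk ⟨β, hβ.trans_le (le_max_left _ _)⟩, n)
    simpa using this
  have hbd : ∀ α, ∃ b, α < κ.ord → b < κ.ord ∧ τ α < b ∧ ∀ k, ∀ β ∈ {β | (y α k).val β ≠ none},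
      β < b := by
    intro α
    by_cases hα : α < κ.ord
    · obtain ⟨b, hb, h⟩ := exists_uniform_bound_of_finite (K := K) (α := κ.ord)
        (Q := fun _ β b => β < b) (by rw [hK, hκ.cof_ord]; exact hμl.trans hlκ)
        (by rw [hκ.cof_ord]; exact hunc.le) (fun k => (y α k).finite_val)
        (fun _ _ _ _ _ hb h => h.trans_le hb)
        fun k β hβ => ⟨β + 1, add_one_lt_ord hκ (SquareLottery.mem_of_val_ne_none hβ).1.1,
          lt_add_one β⟩
      exact ⟨max b (τ α + 1), fun _ => ⟨max_lt hb (add_one_lt_ord hκ (hτ α hα).2.1),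
        (lt_add_one _).trans_le (le_max_right _ _),
        fun k β hβ => (h k β hβ).trans_le (le_max_left _ _)⟩⟩
    · exact ⟨0, fun h => absurd h hα⟩
  choose F hF using hbd
  -- Closure under F puts the whole domain attached to α, and τ α itself, below every later member
  -- of W₃.
  have hW₃ := (isClubIn_closed_under hκ hunc F fun α hα => (hF α hα).1).stationaryIn_inter
    hκ hunc hW₂
  set W₃ := {α ∈ {α ∈ W | η α = η₀} | (fun k => (hfin α k).toFinset) = root} ∩
    {δ | δ < κ.ord ∧ δ ≠ 0 ∧ ∀ α < δ, F α < δ} with hW₃def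
  have hτlt : ∀ α ∈ W₃, ∀ α' ∈ W₃, α < α' → τ α < τ α' := fun α hα α' hα' h =>
    ((hF α hα.2.1).2.1.trans (hα'.2.2.2 α h)).trans (hτ α' hα'.2.1).1
  have hcomp : ∀ α ∈ W₃, ∀ α' ∈ W₃, α < α' → Compatible (en (τ α)) (en (τ α')) := by
    intro α hα α' hα' hlt
    refine fullPower_compatible e fun k => ?_
    change Compatible (y α k) (y α' k)
    have hk := hyidx hα.2.1 k
    have hk' := hyidx hα'.2.1 k
    have hη' := (hη α' hα'.1.1.1).2 k
    rw [hα'.1.1.2] at hη'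
    have hdom : ∀ {β}, (y α k).val β ≠ none → β < α' := fun hβ =>
      ((hF α hα.2.1).2.2 k _ hβ).trans (hα'.2.2.2 α hlt)
    have hroot' := hroot α hα.1 α' hα'.1 k
    refine SquareLottery.compatible_of_val (hk.trans hk'.symm)
      (fun β hβ hβ' => hroot' β ((hη' β hβ').1 (hdom hβ))) fun β γ hβ heq => ?_
    have hγ : (y α' k).val γ ≠ none := heq ▸ hβ
    obtain ⟨hβlim, hβi⟩ := SquareLottery.mem_of_val_ne_none hβ
    -- If γ < α', then γ lies in the common root and both nodes belong to the first condition. If γ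
    -- ≥ α', a predecessor β of γ lies below η₀, so both nodes belong to the second condition.
    rcases lt_or_ge γ α' with hγα | hγα
    · have hγ' := hroot' γ ((hη' γ hγ).1 hγα)
      exact ⟨fun h => SquareLottery.val_ne_of_mem hI hβ h (heq.trans hγ'.symm),
        fun h => SquareLottery.val_ne_of_mem hI (hγ' ▸ hγ) h (hγ'.trans heq.symm)⟩
    · refine ⟨fun h => ?_, fun h => ?_⟩
      · rw [hk] at h
        have hβ' := hroot' β ((hη' γ hγ).2 hγα β h (hdom hβ))
        rw [← hk'] at h
        exact SquareLottery.val_ne_of_mem hI (hβ' ▸ hβ) h (hβ'.symm.trans heq)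
      · have := (hI.club β hβlim _ hβi (y α k).index.2).subset h.1
        exact ((hdom hβ).trans_le hγα).not_gt this
  refine ⟨(fun α => en (τ α)) '' W₃, ?_, ?_, ?_⟩
  · rintro _ ⟨α, -, rfl⟩
    exact henA _
  · refine le_antisymm ?_ ?_
    · rw [← hA]
      refine Cardinal.mk_le_mk_of_subset ?_
      rintro _ ⟨α, -, rfl⟩
      exact henA _
    · by_contra! hlt
      obtain ⟨z, -, hz⟩ := hW₃.exists_fiber_of_mapsTo hκ hunc
        (Y := (fun α => en (τ α)) '' W₃) (by simpa using hlt) (fun α => en (τ α)) fun α hα _ => Set.mem_image_of_mem _ hα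
      obtain ⟨α, hα, -, hακ⟩ := hz.exists_gt hκ hκ.ord_pos
      obtain ⟨β, hβ, hαβ, hβκ⟩ := hz.exists_gt hκ hακ
      exact (hτlt α hα.1 β hβ.1 hαβ).ne
        (hinj _ (hτ α hακ).2.1 _ (hτ β hβκ).2.1 (hα.2.trans hβ.2.symm))
  · rintro _ ⟨α, hα, rfl⟩ _ ⟨β, hβ, rfl⟩ hne
    rcases lt_trichotomy α β with h | rfl | h
    · exact hcomp α hα β hβ h
    · exact absurd rfl hne
    · exact (hcomp β hβ α hα h).symm

end Knaster

/-! ### Descent to the universe of κ and conclusion. -/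

/-- The nodes are ordinals and live one universe too high; being bounded by κ they form small types,
which yields an isomorphic order in `Type u`. -/
instance small_squareLottery (κ l : Cardinal.{u}) (ind : Ordinal.{u} → Ordinal.{u})
    (C : Ordinal.{u} → Ordinal.{u} → Set Ordinal.{u}) : Small.{u} (SquareLottery κ l ind C) := by
  have h1 : ∀ i, Small.{u} (TreeNode κ ind i) := fun i =>
    small_of_injective (β := Set.Iio κ.ord) (f := fun t => ⟨t.1, t.2.1.1⟩) fun t s h =>
      Subtype.ext (congrArg (fun z : Set.Iio κ.ord => z.1) h)
  have h2 : ∀ i, Small.{u} (SpecializingPoset (treeLT κ ind C i)) := fun i =>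
    small_of_injective (f := SpecializingPoset.toFun) fun p q h => SpecializingPoset.ext h
  exact small_of_injective
    (β := Σ i : Set.Iio l.ord, SpecializingPoset (treeLT κ ind C i.1))
    (f := fun x => ⟨x.index, x.cond⟩) fun ⟨i, p⟩ ⟨j, q⟩ h => by
      cases h
      rfl

theorem exists_orderIso_of_small (Q : Type v) [PartialOrder Q] [Small.{u} Q] :
    ∃ (P : Type u) (_ : PartialOrder P), Nonempty (P ≃o Q) :=
  ⟨Shrink.{u} Q, PartialOrder.lift (equivShrink Q).symm (equivShrink Q).symm.injective,
    ⟨@RelIso.mk _ _ (_) _ (equivShrink Q).symm Iff.rfl⟩⟩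

theorem theorem1p4 (κ l : Cardinal.{u}) (hκ : κ.IsRegular) (hκ_unc : ℵ₀ < κ)
    (hsq : SquarePrinciple κ) (hl : l.IsRegular) (hlκ : l < κ) :
    ∃ (P : Type u) (_ : PartialOrder P),
      (∀ μ < l, (∀ ν < κ, ν ^ μ < κ) → IsKnaster κ (FullPower P μ)) ∧
      ¬ ChainCondition κ (FullPower P l) ∧
      ∃ (ind : Ordinal.{u} → Ordinal.{u}) (C : Ordinal.{u} → Ordinal.{u} → Set Ordinal.{u}),
        IsIndexedSquareSeq κ l ind C ∧
        Nonempty (P ≃o Antisymmetrization (SquareLottery κ l ind C) (· ≤ ·)) := by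
  obtain ⟨C₀, hC₀⟩ := hsq
  obtain ⟨C', ind, hclub, hcoh, hind, hst⟩ := hC₀.exists_coloring hκ hκ_unc hl hlκ
    (stationaryIn_cof_eq hκ hl hlκ)
    fun α hα => mem_accPoints_Iio_of_le_cof hα.1 (hα.2 ▸ hl.aleph0_le)
  obtain ⟨C, hrows⟩ := exists_rows (κ := κ) (l := l) hind hclub hcoh
  have hI : IsIndexedSquareSeq κ l ind C := isIndexedSquareSeq_of_stationaryIn hκ hκ_unc hlκ hind
    hrows fun i hi => (hst i hi).mono fun α hα => hα.2
  have : Small.{u} (Antisymmetrization (SquareLottery κ l ind C) (· ≤ ·)) :=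
    small_of_surjective (f := toAntisymmetrization (α := SquareLottery κ l ind C) (· ≤ ·))
      Quotient.mk_surjective
  obtain ⟨P, hP, ⟨e⟩⟩ :=
    exists_orderIso_of_small.{u} (Antisymmetrization (SquareLottery κ l ind C) (· ≤ ·))
  exact ⟨P, hP, fun μ hμ h => isKnaster_fullPower e hκ hκ_unc hl hlκ hI hst hμ h,
    not_chainCondition e hκ hκ_unc hl hlκ hI, ind, C, hI, ⟨e⟩⟩
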